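/- Let $p$ be a prime and let $K$ be an $F$-finite field of characteristic $p$. For a ring $R$ of characteristic $p$ write $R^{1/p^e}$ for $R$ regarded as an $R$-module through the $e$-th iterate of Frobenius ($r\cdot s^{1/p^e}=(r^{p^e}s)^{1/p^e}$); $R$ is $F$-finite if $R^{1/p}$ is a finitely generated $R$-module, and $F$-pure if $R\to R^{1/p}$, $r\mapsto (r^p)^{1/p}$, is a pure map of $R$-modules. Let $R$ be a quotient of a polynomial ring over $K$ by an ideal contained in the ideal generated by the variables, and let $\mathfrak m_R$ be the ideal of $R$ generated by the classes of the variables. Put $$I_e(R)=\{r\in R\mid \varphi(r^{1/p^e})\in\mathfrak m_R\text{ for all }\varphi\in\operatorname{Hom}_R(R^{1/p^e},R)\},\qquad b_I(p^e)=\max\{r\in\mathbb N\mid I^r\nsubseteq I_e(R)\}$$ for an ideal $I\subseteq\mathfrak m_R$, and $$\operatorname{fpt}(R)=\sup\{\lambda\in\mathbb R_{\ge 0}\mid \text{for all } e\gg 0 \text{ there is } f\in\mathfrak m_R^{\lfloor (p^e-1)\lambda\rfloor}\text{ such that } R\to R^{1/p^e},\ 1\mapsto f^{1/p^e},\text{ splits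 over } R\}.$$ **Proposition.** Let $A=K[x_1,\dots,x_n]$, $B=K[y_1,\dots,y_m]$, $S=K[x_1,\dots,x_n,y_1,\dots,y_m]$, let $\mathfrak a\subseteq (x_1,\dots,x_n)A$ and $\mathfrak b\subseteq(y_1,\dots,y_m)B$ be ideals, and let $J=\mathfrak aS+\mathfrak bS$. 1. For every $e\ge 0$, the numbers $b_J(p^e)$, $b_{\mathfrak a}(p^e)$, $b_{\mathfrak b}(p^e)$, computed in $S$, $A$, $B$ respectively, are finite and $b_J(p^e)=b_{\mathfrak a}(p^e)+b_{\mathfrak b}(p^e)$. 2. If moreover $\mathfrak a$ and $\mathfrak b$ are homogeneous and $A/\mathfrak a$ and $B/\mathfrak b$ are $F$-pure, then $S/J$ is $F$-pure, for every $e\ge 0$ the numbers $b_{\mathfrak m_R}(p^e)$, $R\in\{S/J,A/\mathfrak a,B/\mathfrak b\}$, are finite with $$b_{\mathfrak m_{S/J}}(p^e)=b_{\mathfrak m_{A/\mathfrak a}}(p^e)+b_{\mathfrak m_{B/\mathfrak b}}(p^e),$$ and the $F$-pure thresholds are finite with $$\operatorname{fpt}(S/J)=\operatorname{fpt}(A/\mathfrak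 a)+\operatorname{fpt}(B/\mathfrak b).$$ -/

import Mathlib

open scoped NNReal ENNReal TensorProduct

universe u

namespace FThreshold

/-- The `R`-module `R^{1/p^e}`, i.e. the ring `R` with scalars acting through the `e`-th iterate
of Frobenius. Rings of characteristic `p` are taken as `𝔽_p`-algebras. -/
def PRoot (_p _e : ℕ) (R : Type u) : Type u := R

variable (p e : ℕ) {R : Type u} [CommRing R]

instance : AddCommGroup (PRoot p e R) := inferInstanceAs (AddCommGroup R)

/-- The additive bijection `r ↦ r^{1/p^e}` from `R` to `R^{1/p^e}`. -/
def root : R ≃+ PRoot p e R := AddEquiv.refl R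

theorem add_pow_prime_pow [Fact p.Prime] [Algebra (ZMod p) R] (r s : R) :
    (r + s) ^ p ^ e = r ^ p ^ e + s ^ p ^ e := by
  rcases subsingleton_or_nontrivial R with h | h
  · exact Subsingleton.elim _ _
  · have : CharP R p := charP_of_injective_algebraMap (algebraMap (ZMod p) R).injective p
    exact add_pow_char_pow r s p e

/-- Scalar multiplication: `r • s^{1/p^e} = (r^{p^e} s)^{1/p^e}`. -/
instance [Fact p.Prime] [Algebra (ZMod p) R] : Module R (PRoot p e R) where
  smul r x := root p e (r ^ p ^ e * (root p e).symm x)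
  one_smul x := by
    change (1 : R) ^ p ^ e * (show R from x) = x
    rw [one_pow, one_mul]
  mul_smul r s x := by
    change (r * s) ^ p ^ e * (show R from x) = r ^ p ^ e * (s ^ p ^ e * (show R from x))
    rw [mul_pow, mul_assoc]
  smul_zero r := mul_zero (r ^ p ^ e)
  smul_add r x y := mul_add (r ^ p ^ e) (show R from x) (show R from y)
  add_smul r s x := by
    change (r + s) ^ p ^ e * (show R from x)
      = r ^ p ^ e * (show R from x) + s ^ p ^ e * (show R from x)
    rw [add_pow_prime_pow, add_mul]
  zero_smul x := by
    change (0 : R) ^ p ^ e * (show R from x) = (0 : R)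
    rw [zero_pow (pow_ne_zero e (Fact.out : p.Prime).ne_zero), zero_mul]

theorem smul_root [Fact p.Prime] [Algebra (ZMod p) R] (r s : R) :
    r • root p e s = root p e (r ^ p ^ e * s) := rfl

/-- `R` is `F`-finite: `R^{1/p}` is a finitely generated `R`-module. -/
def IsFFinite (p : ℕ) (R : Type u) [CommRing R] [Fact p.Prime] [Algebra (ZMod p) R] : Prop :=
  Module.Finite R (PRoot p 1 R)

/-- `R` is `F`-pure: the Frobenius `R → R^{1/p}`, `r ↦ r • 1^{1/p} = (r^p)^{1/p}`, stays injective
after tensoring with any `R`-module `M`. -/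
def IsFPure (p : ℕ) (R : Type u) [CommRing R] [Fact p.Prime] [Algebra (ZMod p) R] : Prop :=
  ∀ (M : Type u) [AddCommGroup M] [Module R M], Function.Injective
    (LinearMap.rTensor M (LinearMap.toSpanSingleton R (PRoot p 1 R) (root p 1 1)))

/-- The map `R → R^{1/p^e}`, `1 ↦ f^{1/p^e}`, splits as a map of `R`-modules. -/
def RootSplits [Fact p.Prime] [Algebra (ZMod p) R] (f : R) : Prop :=
  ∃ φ : PRoot p e R →ₗ[R] R,
    φ ∘ₗ LinearMap.toSpanSingleton R (PRoot p e R) (root p e f) = LinearMap.id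

/-- The pair `(R, I^t)` is `F`-pure. -/
def IsFPurePair [Fact p.Prime] [Algebra (ZMod p) R] (I : Ideal R) (t : ℝ≥0) : Prop :=
  ∀ᶠ e : ℕ in Filter.atTop, ∃ f ∈ I ^ ⌊((p : ℝ) ^ e - 1) * (t : ℝ)⌋₊, RootSplits p e f

/-- The `F`-pure threshold of `I`; the supremum is taken in `[0, ∞]`. -/
noncomputable def fpt [Fact p.Prime] [Algebra (ZMod p) R] (I : Ideal R) : ℝ≥0∞ :=
  ⨆ (t : ℝ≥0) (_ : IsFPurePair p I t), (t : ℝ≥0∞)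

/-- The ideal `I_e(R)` of all `r` such that `φ(r^{1/p^e}) ∈ 𝔪` for every `R`-linear
`φ : R^{1/p^e} → R`, where `𝔪` is the given maximal homogeneous ideal of `R`. -/
def splittingIdeal [Fact p.Prime] [Algebra (ZMod p) R] (𝔪 : Ideal R) : Ideal R where
  carrier := {r | ∀ φ : PRoot p e R →ₗ[R] R, φ (root p e r) ∈ 𝔪}
  zero_mem' φ := by rw [map_zero, map_zero]; exact 𝔪.zero_mem
  add_mem' hr hs φ := by rw [map_add, map_add]; exact 𝔪.add_mem (hr φ) (hs φ)
  smul_mem' c r hr φ := by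
    let μ : PRoot p e R →ₗ[R] PRoot p e R :=
      { toFun := fun x => root p e (c * (root p e).symm x)
        map_add' := fun x y => mul_add c (show R from x) (show R from y)
        map_smul' := fun t x => mul_left_comm c (t ^ p ^ e) (show R from x) }
    exact hr (φ ∘ₗ μ)

/-- `b_J(p^e) = max {r | J^r ⊄ I_e(R)}`, as a supremum in `ℕ ∪ {∞}`. -/
noncomputable def bNum [Fact p.Prime] [Algebra (ZMod p) R] (𝔪 J : Ideal R) : ℕ∞ :=
  ⨆ (r : ℕ) (_ : ¬ J ^ r ≤ splittingIdeal p e 𝔪), (r : ℕ∞)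

section Polynomial

variable {σ : Type} {K : Type u} [Field K]

/-- Homogeneity of an ideal of `K[x_i : i ∈ σ]` for the standard grading (`deg x_i = 1`). -/
def IsHomogeneousIdeal (a : Ideal (MvPolynomial σ K)) : Prop :=
  letI : GradedAlgebra (MvPolynomial.homogeneousSubmodule σ K) := MvPolynomial.gradedAlgebra
  a.IsHomogeneous (MvPolynomial.homogeneousSubmodule σ K)

/-- The maximal homogeneous ideal of `K[x_i : i ∈ σ] / a`. -/
noncomputable def irrelevantQuot (a : Ideal (MvPolynomial σ K)) : Ideal (MvPolynomial σ K ⧸ a) :=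
  (MvPolynomial.idealOfVars σ K).map (Ideal.Quotient.mk a)

/-- `fpt(K[x_i : i ∈ σ] / a)`, the `F`-pure threshold of the maximal homogeneous ideal. -/
noncomputable def fptQuot [Fact p.Prime] [Algebra (ZMod p) K]
    (a : Ideal (MvPolynomial σ K)) : ℝ≥0∞ :=
  fpt p (irrelevantQuot a)

/-- `b_𝔪(p^e)` for `𝔪` the maximal homogeneous ideal of `K[x_i : i ∈ σ] / a`. -/
noncomputable def bQuot [Fact p.Prime] [Algebra (ZMod p) K]
    (a : Ideal (MvPolynomial σ K)) : ℕ∞ :=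
  bNum p e (irrelevantQuot a) (irrelevantQuot a)

/-- The ideal `a + b` of `K[x, y]` generated by ideals `a` of `K[x]` and `b` of `K[y]`. -/
noncomputable def sumIdeal {σ τ : Type} (a : Ideal (MvPolynomial σ K))
    (b : Ideal (MvPolynomial τ K)) : Ideal (MvPolynomial (σ ⊕ τ) K) :=
  a.map (MvPolynomial.rename (R := K) (Sum.inl : σ → σ ⊕ τ)) ⊔
    b.map (MvPolynomial.rename (R := K) (Sum.inr : τ → σ ⊕ τ))

end Polynomial

end FThreshold

/-!
Write `q = p ^ e`. The argument rests on Fedder's description of `I_e(S ⧸ J)` for a polynomial ring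
`S`, with `𝔪` the ideal of the variables.

Since `K` is `F`-finite, `Hom_S(S^{1/q}, S)` is generated by a single map `tr`, and `S^{1/q}` has
dual bases with respect to it; this is recorded in the structure `FrobeniusDual`, first constructed
for `K` by counting dimensions and then extended to `S` coefficientwise. It follows that
`I_e(S) = 𝔪^{[q]}` (`FrobeniusDual.splittingIdeal_eq`) and that `I_e(S ⧸ J)` is the image of
`𝔪^{[q]} : (J^{[q]} : J)` (`FrobeniusDual.mk_mem_splittingIdeal_iff`). Hence every number `b`
occurring here is the largest `r` such that `c ^ r U ⊄ 𝔪^{[q]}`, where `c` is the given ideal and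
`U` is the unit ideal or `J^{[q]} : J`; see `irrelevantQuot_pow_le_iff`.

For `J = a + b` in separate sets of variables, linear algebra in `K[x, y] = K[x] ⊗ K[y]` gives
`J^{[q]} : J = (a^{[q]} : a) (b^{[q]} : b) + J^{[q]}` (`fedderColon_sumIdeal`), and shows that `f g`
lies in `𝔪_S^{[q]}` for `f ∈ K[x]`, `g ∈ K[y]` only if one of the factors lies in the corresponding
ideal (`rename_mul_rename_notMem`). Expanding the powers of a sum of ideals then makes the numbers
`b` additive (`not_sumIdeal_pow_mul_le_iff`).

If `J` is homogeneous, an element of a power of `𝔪_R` outside `I_e(R)` can be replaced by one whose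
image under some linear map is a nonzero constant, so it generates a split free summand of
`R^{1/q}` (`exists_rootSplits`). In particular `1 ∉ I_1(R)` is equivalent to `F`-purity, because a
pure map from a Noetherian ring to a finite module splits (`exists_apply_eq_one_of_pure`), and the
`F`-pure threshold depends only on the numbers `b(p^e)`. Composing with a splitting of Frobenius
shows `p b(p^e) ≤ b(p^{e+1})`, whence the threshold is the supremum of the nondecreasing sequence
`b(p^e) / p^e` (`fpt_eq_iSup`), and suprema of nondecreasing sequences add up.
-/

namespace FThreshold

/-! ### Frobenius powers and maps on `R^{1/p^e}` -/

section Frobenius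

variable (p e : ℕ) [Fact p.Prime] {R : Type u} [CommRing R] [Algebra (ZMod p) R]

/-- The `e`-th iterate of Frobenius as a ring endomorphism of an `𝔽_p`-algebra. -/
def frob (R : Type u) [CommRing R] [Algebra (ZMod p) R] : R →+* R where
  toFun x := x ^ p ^ e
  map_one' := one_pow _
  map_mul' x y := mul_pow x y _
  map_zero' := zero_pow (pow_ne_zero e (Fact.out : p.Prime).ne_zero)
  map_add' x y := add_pow_prime_pow p e x y

/-- The Frobenius power `I^{[p^e]}`: the ideal generated by all `x ^ p ^ e` with `x ∈ I`. -/
def frobPower (I : Ideal R) : Ideal R := I.map (frob p e R)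

variable {p e}

theorem pow_mem_frobPower {I : Ideal R} {x : R} (hx : x ∈ I) : x ^ p ^ e ∈ frobPower p e I :=
  Ideal.mem_map_of_mem (frob p e R) hx

theorem frobPower_le {I L : Ideal R} (h : ∀ x ∈ I, x ^ p ^ e ∈ L) : frobPower p e I ≤ L :=
  Ideal.map_le_iff_le_comap.2 h

theorem frobPower_mono {I L : Ideal R} (h : I ≤ L) : frobPower p e I ≤ frobPower p e L :=
  Ideal.map_mono h

theorem frobPower_sup (I L : Ideal R) :
    frobPower p e (I ⊔ L) = frobPower p e I ⊔ frobPower p e L :=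
  Ideal.map_sup _ I L

theorem frobPower_map {R' : Type u} [CommRing R'] [Algebra (ZMod p) R'] (f : R →+* R')
    (I : Ideal R) : frobPower p e (I.map f) = (frobPower p e I).map f := by
  rw [frobPower, frobPower, Ideal.map_map, Ideal.map_map]
  congr 1
  ext x
  exact (map_pow f x _).symm

/-- An additive map `f` with `f (a ^ p ^ e * x) = a • f x` is an `R`-linear map on
`R^{1/p^e}`. -/
def linOfAdd {M : Type*} [AddCommGroup M] [Module R M] (f : R →+ M)
    (hf : ∀ a x, f (a ^ p ^ e * x) = a • f x) : PRoot p e R →ₗ[R] M where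
  toFun x := f ((root p e).symm x)
  map_add' x y := by rw [map_add, map_add]
  map_smul' a x := hf a ((root p e).symm x)

theorem map_root_pow_mul {M : Type*} [AddCommGroup M] [Module R M]
    (φ : PRoot p e R →ₗ[R] M) (a x : R) :
    φ (root p e (a ^ p ^ e * x)) = a • φ (root p e x) := by
  rw [← smul_root, map_smul]

theorem mem_splittingIdeal {𝔪 : Ideal R} {r : R} :
    r ∈ splittingIdeal p e 𝔪 ↔ ∀ φ : PRoot p e R →ₗ[R] R, φ (root p e r) ∈ 𝔪 := Iff.rfl

theorem frobPower_le_splittingIdeal (𝔪 : Ideal R) :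
    frobPower p e 𝔪 ≤ splittingIdeal p e 𝔪 := by
  refine frobPower_le fun x hx φ => ?_
  rw [← mul_one (x ^ p ^ e), map_root_pow_mul]
  exact 𝔪.mul_mem_right _ hx

theorem rootSplits_iff {f : R} :
    RootSplits p e f ↔ ∃ φ : PRoot p e R →ₗ[R] R, φ (root p e f) = 1 := by
  refine exists_congr fun φ => ⟨fun h => ?_, fun h => ?_⟩
  · simpa using LinearMap.congr_fun h 1
  · ext
    simpa using h

end Frobenius

/-! ### Trace generators for Frobenius -/

/-- A generator `tr` of `Hom_R(R^{1/q}, R)`, viewed as an additive map `R → R`, together with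
dual bases `u`, `v`: every `x` equals `∑ tr (u_i x)^q v_i`. -/
structure FrobeniusDual (q : ℕ) (R : Type u) [CommRing R] where
  /-- The generator, as an additive endomorphism of `R`. -/
  tr : R →+ R
  tr_pow_mul : ∀ a x, tr (a ^ q * x) = a * tr x
  /-- The index type of the dual bases. -/
  ι : Type
  [fintype : Fintype ι]
  /-- The multipliers giving the coordinate functions `x ↦ tr (u i * x)`. -/
  u : ι → R
  /-- The generators of `R^{1/q}` over `R`. -/
  v : ι → R
  sum_eq : ∀ x, ∑ i, tr (u i * x) ^ q * v i = x

attribute [instance] FrobeniusDual.fintype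

namespace FrobeniusDual

theorem exists_tr_ne_zero {q : ℕ} (hq : q ≠ 0) {R : Type u} [CommRing R]
    (D : FrobeniusDual q R) {x : R} (hx : x ≠ 0) : ∃ c, D.tr (c * x) ≠ 0 := by
  by_contra! h
  refine hx ?_
  rw [← D.sum_eq x]
  exact Finset.sum_eq_zero fun i _ => by rw [h, zero_pow hq, zero_mul]

section General

variable {p e : ℕ} [Fact p.Prime] {R : Type u} [CommRing R] [Algebra (ZMod p) R]

/-- The elements all of whose multiples have trace in `I` lie in `I^{[p^e]}`; the converse is
`tr_mem`. -/
theorem mem_frobPower (D : FrobeniusDual (p ^ e) R) {I : Ideal R} {x : R}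
    (h : ∀ c, D.tr (c * x) ∈ I) : x ∈ frobPower p e I := by
  rw [← D.sum_eq x]
  exact sum_mem fun i _ => Ideal.mul_mem_right _ _ (pow_mem_frobPower (h _))

theorem tr_mem (D : FrobeniusDual (p ^ e) R) {I : Ideal R} {x : R}
    (h : x ∈ frobPower p e I) : D.tr x ∈ I :=
  frobPower_le_splittingIdeal I h (linOfAdd D.tr D.tr_pow_mul)

/-- Over a ring with a trace generator, `I_e(R) = 𝔪^{[p^e]}`. -/
theorem splittingIdeal_eq (D : FrobeniusDual (p ^ e) R) (𝔪 : Ideal R) :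
    splittingIdeal p e 𝔪 = frobPower p e 𝔪 := by
  refine le_antisymm (fun x hx => D.mem_frobPower fun c => ?_) (frobPower_le_splittingIdeal 𝔪)
  refine hx (linOfAdd (D.tr.comp (AddMonoidHom.mulLeft c)) fun a x => ?_)
  simp only [AddMonoidHom.comp_apply, AddMonoidHom.coe_mulLeft, smul_eq_mul]
  rw [mul_left_comm, D.tr_pow_mul]

/-- If `g J ⊆ J^{[p^e]}`, then `tr (g ·)` descends to an `R ⧸ J`-linear map on
`(R ⧸ J)^{1/p^e}`. -/
theorem exists_descend (D : FrobeniusDual (p ^ e) R) {J : Ideal R} {g : R}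
    (hg : ∀ x ∈ J, g * x ∈ frobPower p e J) :
    ∃ φ : PRoot p e (R ⧸ J) →ₗ[R ⧸ J] (R ⧸ J), ∀ x,
      φ (root p e (Ideal.Quotient.mk J x)) = Ideal.Quotient.mk J (D.tr (g * x)) := by
  let f : R →+ R ⧸ J := (Ideal.Quotient.mk J).toAddMonoidHom.comp
    (D.tr.comp (AddMonoidHom.mulLeft g))
  have hf : ∀ x ∈ J.toAddSubgroup, f x = 0 := fun x hx =>
    Ideal.Quotient.eq_zero_iff_mem.2 (D.tr_mem (hg x hx))
  let f' : R ⧸ J →+ R ⧸ J := QuotientAddGroup.lift J.toAddSubgroup f hf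
  have hf' : ∀ x, f' (Ideal.Quotient.mk J x) = Ideal.Quotient.mk J (D.tr (g * x)) := fun x => rfl
  refine ⟨linOfAdd f' fun a x => ?_, fun x => hf' x⟩
  obtain ⟨a, rfl⟩ := Ideal.Quotient.mk_surjective a
  obtain ⟨x, rfl⟩ := Ideal.Quotient.mk_surjective x
  rw [← map_pow, ← map_mul, hf', hf', mul_left_comm, D.tr_pow_mul, map_mul, smul_eq_mul]

/-- Every linear map on `(R ⧸ J)^{1/p^e}` is induced by `tr (g ·)` for some `g` with
`g J ⊆ J^{[p^e]}`. -/
theorem exists_lift (D : FrobeniusDual (p ^ e) R) {J : Ideal R}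
    (φ : PRoot p e (R ⧸ J) →ₗ[R ⧸ J] (R ⧸ J)) :
    ∃ g, (∀ x ∈ J, g * x ∈ frobPower p e J) ∧ ∀ x,
      φ (root p e (Ideal.Quotient.mk J x)) = Ideal.Quotient.mk J (D.tr (g * x)) := by
  choose w hw using fun i =>
    Ideal.Quotient.mk_surjective (φ (root p e (Ideal.Quotient.mk J (D.v i))))
  have key : ∀ x, φ (root p e (Ideal.Quotient.mk J x)) =
      Ideal.Quotient.mk J (D.tr ((∑ i, w i ^ p ^ e * D.u i) * x)) := by
    intro x
    conv_lhs => rw [← D.sum_eq x]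
    simp_rw [Finset.sum_mul, map_sum, mul_assoc, D.tr_pow_mul, map_mul, map_pow,
      map_root_pow_mul, hw, smul_eq_mul, mul_comm]
  refine ⟨∑ i, w i ^ p ^ e * D.u i, fun x hx => D.mem_frobPower fun c => ?_, key⟩
  rw [mul_left_comm, ← Ideal.Quotient.eq_zero_iff_mem, ← key,
    Ideal.Quotient.eq_zero_iff_mem.2 (J.mul_mem_left c hx), map_zero, map_zero]

/-- Fedder's description of the splitting ideal of a quotient:
`I_e(R ⧸ J)` is the image of `𝔪^{[p^e]} : (J^{[p^e]} : J)`. -/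
theorem mk_mem_splittingIdeal_iff (D : FrobeniusDual (p ^ e) R) {J 𝔪 : Ideal R} (hJ : J ≤ 𝔪)
    {x : R} :
    Ideal.Quotient.mk J x ∈ splittingIdeal p e (𝔪.map (Ideal.Quotient.mk J)) ↔
      ∀ g, (∀ y ∈ J, g * y ∈ frobPower p e J) → g * x ∈ frobPower p e 𝔪 := by
  have hmem : ∀ {y}, Ideal.Quotient.mk J y ∈ 𝔪.map (Ideal.Quotient.mk J) ↔ y ∈ 𝔪 :=
    Ideal.mem_quotient_iff_mem hJ
  constructor
  · intro h g hg
    refine D.mem_frobPower fun c => ?_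
    obtain ⟨φ, hφ⟩ := D.exists_descend (J := J) (g := c * g) fun y hy => by
      rw [mul_assoc]; exact Ideal.mul_mem_left _ _ (hg y hy)
    have := h φ
    rwa [hφ, hmem, mul_assoc] at this
  · intro h φ
    obtain ⟨g, hg, hφ⟩ := D.exists_lift φ
    rw [hφ, hmem]
    exact D.tr_mem (h g hg)

theorem finite_quotient (D : FrobeniusDual (p ^ e) R) (J : Ideal R) :
    Module.Finite (R ⧸ J) (PRoot p e (R ⧸ J)) := by
  refine ⟨(Submodule.fg_def).2 ⟨_, Set.finite_range fun i =>
    root p e (Ideal.Quotient.mk J (D.v i)), eq_top_iff.2 fun x _ => ?_⟩⟩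
  obtain ⟨x, rfl⟩ := (root p e).surjective x
  obtain ⟨x, rfl⟩ := Ideal.Quotient.mk_surjective x
  rw [← D.sum_eq x, map_sum, map_sum]
  refine sum_mem fun i _ => ?_
  rw [map_mul, map_pow, ← smul_root]
  exact Submodule.smul_mem _ _ (Submodule.subset_span ⟨i, rfl⟩)

end General

section Field

variable {p : ℕ} [Fact p.Prime] {K : Type u} [Field K] [Algebra (ZMod p) K]

/-- For an `F`-finite field, `Hom_K(K^{1/p}, K)` is one-dimensional over `K^{1/p}`, so any nonzero
linear map `K^{1/p} → K` is a trace generator. -/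
theorem nonempty_of_isFFinite_one (hK : IsFFinite p K) : Nonempty (FrobeniusDual p K) := by
  have : Module.Finite K (PRoot p 1 K) := hK
  have h1 : root p 1 (1 : K) ≠ 0 := by simp
  obtain ⟨θ, hθ⟩ := Module.Projective.exists_dual_ne_zero K h1
  let T : PRoot p 1 K →ₗ[K] Module.Dual K (PRoot p 1 K) :=
    { toFun := fun c => linOfAdd (((θ : PRoot p 1 K →+ K).comp (root p 1).toAddMonoidHom).comp
        (AddMonoidHom.mulLeft ((root p 1).symm c))) fun a x => by
          change θ (root p 1 (_ * (_ * x))) = a • θ (root p 1 (_ * x))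
          rw [mul_left_comm, map_root_pow_mul]
      map_add' := fun c d => by
        ext x
        change θ (root p 1 (_ * _)) = θ (root p 1 (_ * _)) + θ (root p 1 (_ * _))
        rw [map_add, add_mul, map_add, map_add]
      map_smul' := fun a c => by
        ext x
        change θ (root p 1 (a ^ p ^ 1 * _ * _)) = a • θ (root p 1 (_ * _))
        rw [mul_assoc, map_root_pow_mul] }
  have hT : ∀ c x, T (root p 1 c) (root p 1 x) = θ (root p 1 (c * x)) := fun c x => rfl
  -- `T c = θ (c ·)` is injective, hence bijective onto the dual; the `u_i` are the preimages of the
  -- coordinate forms of a basis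
  have hinj : Function.Injective T := by
    rw [← LinearMap.ker_eq_bot, LinearMap.ker_eq_bot']
    intro c hc
    obtain ⟨c, rfl⟩ := (root p 1).surjective c
    by_contra hne
    have hc0 : c ≠ 0 := fun h => hne (by rw [h, map_zero])
    apply hθ
    rw [← mul_inv_cancel₀ hc0, ← hT, hc, LinearMap.zero_apply]
  have hsurj : Function.Surjective T :=
    (LinearMap.injective_iff_surjective_of_finrank_eq_finrank
      Subspace.dual_finrank_eq.symm).1 hinj
  let B := Module.finBasis K (PRoot p 1 K)
  choose c hc using fun i => hsurj (B.coord i)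
  refine ⟨{ tr := (θ : PRoot p 1 K →+ K).comp (root p 1).toAddMonoidHom, tr_pow_mul := ?_, ι := _,
            u := fun i => (root p 1).symm (c i), v := fun i => (root p 1).symm (B i),
            sum_eq := ?_ }⟩
  · intro a x
    change θ (root p 1 (a ^ p * x)) = a • θ (root p 1 x)
    rw [← map_root_pow_mul, pow_one]
  · intro x
    have := B.sum_repr (root p 1 x)
    have h2 := congrArg (root p 1).symm this
    rw [map_sum, AddEquiv.symm_apply_apply] at h2
    refine Eq.trans (Finset.sum_congr rfl fun i _ => ?_) h2
    have h3 : B.repr (root p 1 x) i = θ (root p 1 ((root p 1).symm (c i) * x)) := by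
      rw [← hT, AddEquiv.apply_symm_apply, hc, Module.Basis.coord_apply]
    rw [h3]
    exact congrArg (fun n => θ (root p 1 ((root p 1).symm (c i) * x)) ^ n *
      (root p 1).symm (B i)) (pow_one p).symm

/-- Trace generators for `q` and `q'` compose to one for `q * q'`. -/
def comp {q q' : ℕ} {R : Type u} [CommRing R] (D : FrobeniusDual q R)
    (D' : FrobeniusDual q' R) (hadd : ∀ (s : Finset D'.ι) (f : D'.ι → R),
      (∑ i ∈ s, f i) ^ q = ∑ i ∈ s, f i ^ q) : FrobeniusDual (q * q') R where
  tr := D'.tr.comp D.tr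
  tr_pow_mul a x := by
    rw [AddMonoidHom.comp_apply, mul_comm q q', pow_mul, D.tr_pow_mul, D'.tr_pow_mul]
    rfl
  ι := D.ι × D'.ι
  u i := D'.u i.2 ^ q * D.u i.1
  v i := D'.v i.2 ^ q * D.v i.1
  sum_eq x := by
    rw [Fintype.sum_prod_type]
    conv_rhs => rw [← D.sum_eq x]
    refine Finset.sum_congr rfl fun i _ => ?_
    conv_rhs => rw [← D'.sum_eq (D.tr (D.u i * x)), hadd, Finset.sum_mul]
    refine Finset.sum_congr rfl fun j _ => ?_
    rw [AddMonoidHom.comp_apply, mul_assoc (D'.u j ^ q), D.tr_pow_mul, mul_comm q q', pow_mul,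
      mul_pow, mul_assoc]

theorem nonempty_of_isFFinite (hK : IsFFinite p K) (e : ℕ) :
    Nonempty (FrobeniusDual (p ^ e) K) := by
  induction e with
  | zero =>
    exact ⟨{ tr := AddMonoidHom.id K, tr_pow_mul := by simp, ι := Unit, u := 1, v := 1,
             sum_eq := by simp }⟩
  | succ e ih =>
    obtain ⟨D⟩ := ih
    obtain ⟨D'⟩ := nonempty_of_isFFinite_one hK
    exact ⟨D.comp D' fun s f => map_sum (frob p e K) f s⟩

end Field

/-! ### The trace generator of a polynomial ring -/

section Polynomial

open MvPolynomial

variable {σ : Type} {K : Type u} [Field K]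

/-- The exponent `(m, …, m)`. -/
noncomputable def constExp (σ : Type) [Finite σ] (m : ℕ) : σ →₀ ℕ :=
  Finsupp.equivFunOnFinite.symm fun _ => m

@[simp] theorem constExp_apply [Finite σ] (m : ℕ) (i : σ) : constExp σ m i = m := rfl

theorem smul_add_injective {q : ℕ} (hq : q ≠ 0) (w : σ →₀ ℕ) :
    Function.Injective fun β : σ →₀ ℕ => q • β + w := by
  intro β γ h
  ext i
  have := DFunLike.congr_fun h i
  simpa [hq] using this

/-- The trace of a polynomial ring: the coefficient of `x ^ β` in `polyTr θ f` is `θ` of the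
coefficient of `x ^ (q β + (q - 1, …, q - 1))` in `f`. -/
noncomputable def polyTr [Finite σ] {q : ℕ} (hq : q ≠ 0) (θ : K →+ K) :
    MvPolynomial σ K →+ MvPolynomial σ K where
  toFun f := .ofCoeff (Finsupp.mapRange θ (map_zero θ) (Finsupp.comapDomain
    (fun β : σ →₀ ℕ => q • β + constExp σ (q - 1)) (AddMonoidAlgebra.coeff f)
    (smul_add_injective hq _).injOn))
  map_zero' := by
    ext β
    exact map_zero θ
  map_add' f g := by
    ext β
    exact map_add θ _ _

theorem coeff_polyTr [Finite σ] {q : ℕ} (hq : q ≠ 0) (θ : K →+ K) (f : MvPolynomial σ K)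
    (β : σ →₀ ℕ) :
    coeff β (polyTr hq θ f) = θ (coeff (q • β + constExp σ (q - 1)) f) := rfl

theorem polyTr_monomial [Finite σ] {q : ℕ} (hq : q ≠ 0) (θ : K →+ K) (β : σ →₀ ℕ) (c : K) :
    polyTr hq θ (monomial (q • β + constExp σ (q - 1)) c) = monomial β (θ c) := by
  classical
  ext γ
  rw [coeff_polyTr, coeff_monomial, coeff_monomial]
  by_cases h : β = γ
  · simp [h]
  · rw [if_neg h, if_neg fun h' => h (smul_add_injective hq _ h'), map_zero]

theorem polyTr_monomial_eq_zero [Finite σ] {q : ℕ} (hq : q ≠ 0) (θ : K →+ K) {m : σ →₀ ℕ}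
    (h : ∀ β, q • β + constExp σ (q - 1) ≠ m) (c : K) :
    polyTr hq θ (monomial m c) = 0 := by
  classical
  ext γ
  rw [coeff_polyTr, coeff_monomial, if_neg fun h' => h γ h'.symm, map_zero, coeff_zero]

/-- `polyTr θ` inherits Frobenius-semilinearity from `θ`. -/
theorem polyTr_pow_mul {p e : ℕ} [Fact p.Prime] [Algebra (ZMod p) K] [Finite σ]
    (hq : p ^ e ≠ 0) (θ : K →+ K) (hθ : ∀ a x, θ (a ^ p ^ e * x) = a * θ x)
    (a f : MvPolynomial σ K) :
    polyTr hq θ (a ^ p ^ e * f) = a * polyTr hq θ f := by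
  classical
  induction a using MvPolynomial.induction_on' with
  | add a b h1 h2 => rw [add_pow_prime_pow, add_mul, map_add, h1, h2, add_mul]
  | monomial γ c =>
    ext β
    have hiff : p ^ e • γ ≤ p ^ e • β + constExp σ (p ^ e - 1) ↔ γ ≤ β := by
      refine forall_congr' fun i => ?_
      simp only [Finsupp.smul_apply, Finsupp.add_apply, constExp_apply, smul_eq_mul]
      constructor
      · intro h
        by_contra! hlt
        have := Nat.mul_le_mul_left (p ^ e) (Nat.succ_le_of_lt hlt)
        rw [Nat.mul_succ] at this
        omega
      · intro h
        exact (Nat.mul_le_mul_left _ h).trans (Nat.le_add_right _ _)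
    rw [coeff_polyTr, monomial_pow, coeff_monomial_mul', coeff_monomial_mul']
    simp_rw [hiff]
    split_ifs with h
    · rw [hθ, coeff_polyTr]
      congr 3
      ext i
      have := Nat.mul_le_mul_left (p ^ e) (h i)
      simp only [Finsupp.smul_apply, Finsupp.add_apply, Finsupp.tsub_apply, constExp_apply,
        smul_eq_mul, Nat.mul_sub]
      omega
    · exact map_zero θ

/-- A trace generator for `K` induces one for `K[x_i : i ∈ σ]`; the dual bases consist of the
products of those of `K` with the monomials `x ^ α`, `α < q`. -/
noncomputable def mvPolynomial {p e : ℕ} [Fact p.Prime] [Algebra (ZMod p) K] [Fintype σ]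
    [DecidableEq σ] (D : FrobeniusDual (p ^ e) K) :
    FrobeniusDual (p ^ e) (MvPolynomial σ K) where
  tr := polyTr (pow_ne_zero e (Fact.out : p.Prime).ne_zero) D.tr
  tr_pow_mul := polyTr_pow_mul _ _ D.tr_pow_mul
  ι := (σ → Fin (p ^ e)) × D.ι
  u i := monomial (Finsupp.equivFunOnFinite.symm fun j => p ^ e - 1 - (i.1 j : ℕ)) (D.u i.2)
  v i := monomial (Finsupp.equivFunOnFinite.symm fun j => (i.1 j : ℕ)) (D.v i.2)
  sum_eq f := by
    have hq : 0 < p ^ e := pow_pos (Fact.out : p.Prime).pos e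
    induction f using MvPolynomial.induction_on' with
    | add f g h1 h2 =>
      simp only [mul_add, map_add, add_pow_prime_pow, add_mul, Finset.sum_add_distrib]
      exact congrArg₂ _ h1 h2
    | monomial γ c =>
      rw [Fintype.sum_prod_type]
      -- only the exponent `α = γ mod q` contributes
      rw [Finset.sum_eq_single_of_mem (fun j => (⟨γ j % p ^ e, Nat.mod_lt _ hq⟩ : Fin (p ^ e)))
        (Finset.mem_univ _)]
      · have h1 : (Finsupp.equivFunOnFinite.symm fun j => p ^ e - 1 - γ j % p ^ e) + γ =
            p ^ e • (Finsupp.equivFunOnFinite.symm fun j => γ j / p ^ e) +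
              constExp σ (p ^ e - 1) := by
          ext j
          have h2 := Nat.mod_add_div (γ j) (p ^ e)
          have h3 := Nat.mod_lt (γ j) hq
          simp only [Finsupp.add_apply, Finsupp.smul_apply, constExp_apply, smul_eq_mul,
            Finsupp.equivFunOnFinite_symm_apply_apply]
          omega
        have h2 : p ^ e • (Finsupp.equivFunOnFinite.symm fun j => γ j / p ^ e) +
            (Finsupp.equivFunOnFinite.symm fun j => γ j % p ^ e) = γ := by
          ext j
          exact Nat.div_add_mod (γ j) (p ^ e)
        simp only [monomial_mul, h1, polyTr_monomial, monomial_pow, h2]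
        rw [← map_sum, D.sum_eq]
      · intro α _ hα
        refine Finset.sum_eq_zero fun i _ => ?_
        simp only [monomial_mul]
        rw [polyTr_monomial_eq_zero, zero_pow hq.ne', zero_mul]
        intro β hβ
        refine hα (funext fun j => Fin.ext ?_)
        have h1 := DFunLike.congr_fun hβ j
        simp only [Finsupp.add_apply, Finsupp.smul_apply, constExp_apply, smul_eq_mul,
          Finsupp.equivFunOnFinite_symm_apply_apply] at h1
        have h2 := (α j).isLt
        have h3 : γ j = p ^ e * β j + α j := by omega
        simp only [h3, Nat.mul_add_mod, Nat.mod_eq_of_lt h2]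

theorem mvPolynomial_tr {p e : ℕ} [Fact p.Prime] [Algebra (ZMod p) K] [Fintype σ]
    [DecidableEq σ] (D : FrobeniusDual (p ^ e) K) (f : MvPolynomial σ K) (β : σ →₀ ℕ) :
    coeff β ((D.mvPolynomial (σ := σ)).tr f) =
      D.tr (coeff (p ^ e • β + constExp σ (p ^ e - 1)) f) := rfl

end Polynomial

end FrobeniusDual

/-! ### Ideals of a tensor product over a field -/

section Tensor

open TensorProduct

variable {K : Type u} [Field K]

/-- The slice `id ⊗ ℓ : A ⊗ B → A` of a linear form `ℓ` on `B`; it is `A`-linear. -/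
noncomputable def slice (A : Type u) {B : Type u} [CommRing A] [Algebra K A] [CommRing B]
    [Algebra K B] (ℓ : B →ₗ[K] K) : A ⊗[K] B →ₗ[A] A :=
  (AlgebraTensorModule.rid K A A).toLinearMap ∘ₗ AlgebraTensorModule.lTensor A A ℓ

variable {A B : Type u} [CommRing A] [Algebra K A] [CommRing B] [Algebra K B]

@[simp] theorem slice_tmul (ℓ : B →ₗ[K] K) (x : A) (y : B) :
    slice A ℓ (x ⊗ₜ[K] y) = ℓ y • x := by
  simp [slice]

theorem slice_tmul_one_mul (ℓ : B →ₗ[K] K) (a : A) (z : A ⊗[K] B) :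
    slice A ℓ ((a ⊗ₜ[K] 1) * z) = a * slice A ℓ z := by
  induction z with
  | zero => simp
  | add z w hz hw => rw [mul_add, map_add, hz, hw, map_add, mul_add]
  | tmul x y => simp

/-- The ideal `V ⊗ B + A ⊗ W` of `A ⊗ B`. -/
noncomputable def tensorSum (V : Ideal A) (W : Ideal B) : Ideal (A ⊗[K] B) :=
  V.map (Algebra.TensorProduct.includeLeft : A →ₐ[K] A ⊗[K] B) ⊔
    W.map (Algebra.TensorProduct.includeRight : B →ₐ[K] A ⊗[K] B)

/-- Slices by linear forms vanishing on `W` send `V ⊗ B + A ⊗ W` into `V`. -/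
theorem slice_mem {V : Ideal A} {W : Ideal B} {ℓ : B →ₗ[K] K} (hℓ : ∀ y ∈ W, ℓ y = 0)
    {z : A ⊗[K] B} (hz : z ∈ tensorSum V W) : slice A ℓ z ∈ V := by
  rw [tensorSum, Ideal.map, Ideal.map, ← Ideal.span_union] at hz
  refine Submodule.span_induction (p := fun z _ => ∀ w, slice A ℓ (w * z) ∈ V) ?_ (by simp)
    (fun x y _ _ hx hy w => by rw [mul_add, map_add]; exact add_mem (hx w) (hy w))
    (fun c x _ hx w => by rw [smul_eq_mul, ← mul_assoc]; exact hx _) hz 1 |> (by simpa using ·)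
  rintro _ (⟨x, hx, rfl⟩ | ⟨y, hy, rfl⟩) w
  · simp only [Algebra.TensorProduct.includeLeft_apply]
    rw [mul_comm, slice_tmul_one_mul]
    exact V.mul_mem_right _ hx
  · induction w with
    | zero => simp
    | add w w' h h' => rw [add_mul, map_add]; exact add_mem h h'
    | tmul a b =>
      have : ℓ (b * y) = 0 := hℓ _ (W.mul_mem_left b hy)
      simp [this]

theorem tmul_mem_tensorSum_left {V : Ideal A} (W : Ideal B) {x : A} (hx : x ∈ V) (y : B) :
    x ⊗ₜ[K] y ∈ tensorSum V W := by
  have h : x ⊗ₜ[K] y = (x ⊗ₜ[K] 1) * (1 ⊗ₜ[K] y) := by simp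
  rw [h]
  exact Ideal.mul_mem_right _ _ (Ideal.mem_sup_left (Ideal.mem_map_of_mem _ hx))

theorem tmul_mem_tensorSum_right (V : Ideal A) {W : Ideal B} (x : A) {y : B} (hy : y ∈ W) :
    x ⊗ₜ[K] y ∈ tensorSum V W := by
  have h : x ⊗ₜ[K] y = (x ⊗ₜ[K] 1) * (1 ⊗ₜ[K] y) := by simp
  rw [h]
  exact Ideal.mul_mem_left _ _ (Ideal.mem_sup_right (Ideal.mem_map_of_mem _ hy))

theorem comm_mem_tensorSum {V : Ideal A} {W : Ideal B} {z : A ⊗[K] B}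
    (hz : z ∈ tensorSum V W) : Algebra.TensorProduct.comm K A B z ∈ tensorSum W V := by
  have h : tensorSum V W ≤ (tensorSum W V).comap (Algebra.TensorProduct.comm K A B) :=
    sup_le (Ideal.map_le_iff_le_comap.2 fun x hx => tmul_mem_tensorSum_right W 1 hx)
      (Ideal.map_le_iff_le_comap.2 fun y hy => tmul_mem_tensorSum_left V hy 1)
  exact h hz

/-- A linear form vanishing on `W` but not at `y` slices `x ⊗ y` to a nonzero multiple of `x`. -/
theorem tmul_notMem_tensorSum {V : Ideal A} {W : Ideal B} {x : A} (hx : x ∉ V) {y : B}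
    (hy : y ∉ W) : x ⊗ₜ[K] y ∉ tensorSum V W := by
  intro h
  obtain ⟨ℓ, hℓy, hℓ⟩ := Submodule.exists_le_ker_of_notMem
    (p := W.restrictScalars K) (v := y) hy
  have h1 := slice_mem (fun z hz => hℓ hz) h
  rw [slice_tmul] at h1
  refine hx ?_
  have h2 := Submodule.smul_of_tower_mem V (ℓ y)⁻¹ h1
  rwa [smul_smul, inv_mul_cancel₀ hℓy, one_smul] at h2

/-- The slices separate the elements of `A ⊗ B`. -/
theorem eq_of_slice_eq {z w : A ⊗[K] B} (h : ∀ ℓ : B →ₗ[K] K, slice A ℓ z = slice A ℓ w) :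
    z = w := by
  classical
  let b := Module.Basis.ofVectorSpace K B
  apply (TensorProduct.equivFinsuppOfBasisRight (M := A) b).injective
  have key : ∀ (z : A ⊗[K] B) i,
      TensorProduct.equivFinsuppOfBasisRight b z i = slice A (b.coord i) z := by
    intro z i
    induction z with
    | zero => simp
    | add z w hz hw => simp [hz, hw]
    | tmul x y => simp
  ext i
  rw [key, key, h]

theorem slice_map (ℓ : B →ₗ[K] K) (f : A →ₗ[K] A) (g : B →ₗ[K] B) (z : A ⊗[K] B) :
    slice A ℓ (TensorProduct.map f g z) = f (slice A (ℓ ∘ₗ g) z) := by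
  induction z with
  | zero => simp
  | add z w hz hw => simp only [map_add, hz, hw]
  | tmul x y => simp

theorem comm_map (f : A →ₗ[K] A) (g : B →ₗ[K] B) (z : A ⊗[K] B) :
    Algebra.TensorProduct.comm K A B (TensorProduct.map f g z) =
      TensorProduct.map g f (Algebra.TensorProduct.comm K A B z) := by
  induction z with
  | zero => simp
  | add z w hz hw => simp only [map_add, hz, hw]
  | tmul x y => simp

theorem exists_retraction (U : Submodule K A) :
    ∃ f : A →ₗ[K] A, (∀ x, f x ∈ U) ∧ ∀ x ∈ U, f x = x := by
  obtain ⟨g, hg⟩ := LinearMap.exists_leftInverse_of_injective U.subtype U.ker_subtype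
  refine ⟨U.subtype ∘ₗ g, fun x => (g x).2, fun x hx => ?_⟩
  exact congrArg Subtype.val (LinearMap.congr_fun hg ⟨x, hx⟩)

/-- If every slice of `z` lies in the subspace fixed by `f`, then `f ⊗ id` fixes `z`. -/
theorem rTensor_eq_self {f : A →ₗ[K] A} {z : A ⊗[K] B}
    (h : ∀ ℓ : B →ₗ[K] K, f (slice A ℓ z) = slice A ℓ z) :
    TensorProduct.map f LinearMap.id z = z :=
  eq_of_slice_eq fun ℓ => by rw [slice_map, LinearMap.comp_id, h]

/-- An element of `A ⊗ B` whose slices lie in the ideals `U` and `U'` lies in `U ⊗ U'`. -/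
theorem mem_map_mul_map_of_slice_mem {U : Ideal A} {U' : Ideal B} {z : A ⊗[K] B}
    (h : ∀ ℓ : B →ₗ[K] K, slice A ℓ z ∈ U)
    (h' : ∀ ℓ : A →ₗ[K] K, slice B ℓ (Algebra.TensorProduct.comm K A B z) ∈ U') :
    z ∈ U.map (Algebra.TensorProduct.includeLeft : A →ₐ[K] A ⊗[K] B) *
      U'.map (Algebra.TensorProduct.includeRight : B →ₐ[K] A ⊗[K] B) := by
  obtain ⟨f, hf, hf'⟩ := exists_retraction (U.restrictScalars K)
  obtain ⟨g, hg, hg'⟩ := exists_retraction (U'.restrictScalars K)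
  have h1 : TensorProduct.map f LinearMap.id z = z := rTensor_eq_self fun ℓ => hf' _ (h ℓ)
  have h2 : TensorProduct.map LinearMap.id g z = z := by
    apply (Algebra.TensorProduct.comm K A B).injective
    rw [comm_map]
    exact rTensor_eq_self fun ℓ => hg' _ (h' ℓ)
  rw [← h2, ← h1]
  generalize z = w
  induction w with
  | zero => simp
  | add z w hz hw => simp only [map_add]; exact add_mem hz hw
  | tmul x y =>
    have h3 : f x ⊗ₜ[K] g y = (f x ⊗ₜ[K] 1) * (1 ⊗ₜ[K] g y) := by simp
    simp only [map_tmul, LinearMap.id_apply, h3]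
    exact Ideal.mul_mem_mul (Ideal.mem_map_of_mem _ (hf x)) (Ideal.mem_map_of_mem _ (hg y))

/-- A linear endomorphism of `A` killing `V` and congruent to the identity modulo `V`. -/
theorem exists_section (V : Submodule K A) :
    ∃ s : A →ₗ[K] A, (∀ x ∈ V, s x = 0) ∧ ∀ x, x - s x ∈ V := by
  obtain ⟨f, hf, hf'⟩ := exists_retraction V
  refine ⟨LinearMap.id - f, fun x hx => ?_, fun x => ?_⟩
  · simp [hf' x hx]
  · simpa using hf x

/-- Half of the computation of the colon ideal: slicing an element of `(V ⊗ B + A ⊗ W) : a`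
by a form that kills `W` gives an element of `V : a`. -/
theorem slice_mem_colon {V a : Ideal A} {W : Ideal B} {h : A ⊗[K] B}
    (ha : ∀ x ∈ a, h * (x ⊗ₜ[K] 1) ∈ tensorSum V W) {ℓ : B →ₗ[K] K} (hℓ : ∀ y ∈ W, ℓ y = 0) :
    slice A ℓ h ∈ V.colon (a : Set A) := by
  rw [Submodule.mem_colon]
  intro x hx
  have := slice_mem hℓ (ha x hx)
  rwa [mul_comm, slice_tmul_one_mul, mul_comm] at this

/-- `(V ⊗ B + A ⊗ W) : (a ⊗ B + A ⊗ b) ⊆ (V : a) ⊗ (W : b) + V ⊗ B + A ⊗ W`. -/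
theorem mem_colon_mul_colon_sup {V a : Ideal A} {W b : Ideal B} {h : A ⊗[K] B}
    (ha : ∀ x ∈ a, h * (x ⊗ₜ[K] 1) ∈ tensorSum V W)
    (hb : ∀ y ∈ b, h * (1 ⊗ₜ[K] y) ∈ tensorSum V W) :
    h ∈ (V.colon (a : Set A)).map (Algebra.TensorProduct.includeLeft : A →ₐ[K] A ⊗[K] B) *
      (W.colon (b : Set B)).map (Algebra.TensorProduct.includeRight : B →ₐ[K] A ⊗[K] B) ⊔
        tensorSum V W := by
  obtain ⟨s, hs, hs'⟩ := exists_section (V.restrictScalars K)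
  obtain ⟨t, ht, ht'⟩ := exists_section (W.restrictScalars K)
  -- `h` is replaced by a representative modulo `V ⊗ B + A ⊗ W` all of whose slices are controlled
  have hsub : h - TensorProduct.map s t h ∈ tensorSum V W := by
    clear ha hb
    induction h with
    | zero => simp
    | add z w hz hw =>
      rw [map_add, add_sub_add_comm]
      exact add_mem hz hw
    | tmul x y =>
      have h3 : x ⊗ₜ[K] y - s x ⊗ₜ[K] t y = (x - s x) ⊗ₜ[K] y + s x ⊗ₜ[K] (y - t y) := by
        rw [sub_tmul, tmul_sub]; abel
      rw [map_tmul, h3]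
      exact add_mem (tmul_mem_tensorSum_left W (hs' x) y) (tmul_mem_tensorSum_right V _ (ht' y))
  have hmem : ∀ {C : Type u} [CommRing C] [Algebra K C] {V : Ideal C} {S : Set C}
      {s : C →ₗ[K] C} (_ : ∀ x, x - s x ∈ V) {u : C}, u ∈ V.colon S → s u ∈ V.colon S := by
    intro C _ _ V S s hs u hu
    have := sub_mem hu (Ideal.le_colon (hs u))
    rwa [sub_sub_cancel] at this
  rw [← sub_add_cancel h (TensorProduct.map s t h), add_comm]
  refine Submodule.add_mem_sup (mem_map_mul_map_of_slice_mem (fun ℓ => ?_) fun ℓ => ?_) hsub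
  · rw [slice_map]
    exact hmem hs' (slice_mem_colon ha fun y hy => by simp [ht y hy])
  · rw [comm_map, slice_map]
    refine hmem ht' (slice_mem_colon (W := V) (fun y hy => ?_) fun x hx => by simp [hs x hx])
    have := comm_mem_tensorSum (hb y hy)
    rwa [map_mul, Algebra.TensorProduct.comm_tmul] at this

end Tensor

/-! ### Sums of ideals in disjoint sets of variables -/

section SumIdeal

open MvPolynomial

variable {σ τ : Type} {K : Type u} [Field K]

/-- The isomorphism `K[x] ⊗ K[y] → K[x, y]` as an algebra map. -/
noncomputable abbrev tensorToSum (σ τ : Type) (K : Type u) [Field K] :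
    MvPolynomial σ K ⊗[K] MvPolynomial τ K →ₐ[K] MvPolynomial (σ ⊕ τ) K :=
  (tensorEquivSum K σ τ K).toAlgHom

theorem tensorEquivSum_tmul_one (f : MvPolynomial σ K) :
    tensorEquivSum K σ τ K (f ⊗ₜ 1) = rename Sum.inl f := by
  have h : ((tensorToSum σ τ K).comp
      Algebra.TensorProduct.includeLeft) = rename Sum.inl := by
    ext i
    simp
  exact DFunLike.congr_fun h f

theorem tensorEquivSum_one_tmul (f : MvPolynomial τ K) :
    tensorEquivSum K σ τ K (1 ⊗ₜ f) = rename Sum.inr f := by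
  have h : ((tensorToSum σ τ K).comp
      Algebra.TensorProduct.includeRight) = rename Sum.inr := by
    ext i
    simp
  exact DFunLike.congr_fun h f

theorem map_tensorEquivSum_map_includeLeft (a : Ideal (MvPolynomial σ K)) :
    (a.map (Algebra.TensorProduct.includeLeft :
      MvPolynomial σ K →ₐ[K] MvPolynomial σ K ⊗[K] MvPolynomial τ K)).map
        (tensorToSum σ τ K) =
      a.map (rename (R := K) (Sum.inl : σ → σ ⊕ τ)) := by
  rw [Ideal.map_mapₐ]
  congr 1
  ext i
  simp

theorem map_tensorEquivSum_map_includeRight (b : Ideal (MvPolynomial τ K)) :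
    (b.map (Algebra.TensorProduct.includeRight :
      MvPolynomial τ K →ₐ[K] MvPolynomial σ K ⊗[K] MvPolynomial τ K)).map
        (tensorToSum σ τ K) =
      b.map (rename (R := K) (Sum.inr : τ → σ ⊕ τ)) := by
  rw [Ideal.map_mapₐ]
  congr 1
  ext i
  simp

theorem map_tensorSum (a : Ideal (MvPolynomial σ K)) (b : Ideal (MvPolynomial τ K)) :
    (tensorSum a b).map (tensorToSum σ τ K) = sumIdeal a b := by
  rw [tensorSum, Ideal.map_sup, map_tensorEquivSum_map_includeLeft,
    map_tensorEquivSum_map_includeRight, sumIdeal]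

theorem apply_mem_sumIdeal_iff {a : Ideal (MvPolynomial σ K)} {b : Ideal (MvPolynomial τ K)}
    {z : MvPolynomial σ K ⊗[K] MvPolynomial τ K} :
    tensorEquivSum K σ τ K z ∈ sumIdeal a b ↔ z ∈ tensorSum a b := by
  rw [← map_tensorSum]
  refine ⟨fun h => ?_, fun h => Ideal.mem_map_of_mem (tensorToSum σ τ K) h⟩
  obtain ⟨w, hw, hwz⟩ := (Ideal.mem_map_of_equiv (tensorEquivSum K σ τ K) _).1 h
  rwa [← (tensorEquivSum K σ τ K).injective hwz]

/-- A product of polynomials in disjoint variables, neither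
of which lies in the respective ideal, is not in the sum of the ideals. -/
theorem rename_mul_rename_notMem {𝔫 : Ideal (MvPolynomial σ K)} {𝔫' : Ideal (MvPolynomial τ K)}
    {f : MvPolynomial σ K} {g : MvPolynomial τ K} (hf : f ∉ 𝔫) (hg : g ∉ 𝔫') :
    rename Sum.inl f * rename Sum.inr g ∉ sumIdeal 𝔫 𝔫' := by
  rw [← tensorEquivSum_tmul_one, ← tensorEquivSum_one_tmul, ← map_mul, apply_mem_sumIdeal_iff]
  simpa using tmul_notMem_tensorSum hf hg

theorem sumIdeal_mono {a a' : Ideal (MvPolynomial σ K)} {b b' : Ideal (MvPolynomial τ K)}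
    (h : a ≤ a') (h' : b ≤ b') : sumIdeal a b ≤ sumIdeal a' b' :=
  sup_le_sup (Ideal.map_mono h) (Ideal.map_mono h')

theorem sumIdeal_idealOfVars :
    sumIdeal (idealOfVars σ K) (idealOfVars τ K) = idealOfVars (σ ⊕ τ) K := by
  have h : Set.range (X : σ ⊕ τ → MvPolynomial (σ ⊕ τ) K) =
      rename Sum.inl '' Set.range X ∪ rename Sum.inr '' Set.range X := by
    ext f
    simp
  rw [sumIdeal, idealOfVars, idealOfVars, idealOfVars, Ideal.map_span, Ideal.map_span,
    ← Ideal.span_union, h]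

theorem frobPower_sumIdeal {p e : ℕ} [Fact p.Prime] [Algebra (ZMod p) K]
    (a : Ideal (MvPolynomial σ K)) (b : Ideal (MvPolynomial τ K)) :
    frobPower p e (sumIdeal a b) = sumIdeal (frobPower p e a) (frobPower p e b) := by
  rw [sumIdeal, frobPower_sup]
  exact congrArg₂ _ (frobPower_map (rename Sum.inl : MvPolynomial σ K →ₐ[K] _).toRingHom a)
    (frobPower_map (rename Sum.inr : MvPolynomial τ K →ₐ[K] _).toRingHom b)

/-- The product of the extensions of `U` and `V` to `K[x, y]`. -/
noncomputable def prodIdeal (U : Ideal (MvPolynomial σ K)) (V : Ideal (MvPolynomial τ K)) :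
    Ideal (MvPolynomial (σ ⊕ τ) K) :=
  U.map (rename (R := K) (Sum.inl : σ → σ ⊕ τ)) * V.map (rename (R := K) (Sum.inr : τ → σ ⊕ τ))

/-- `(J^{[q]} : J) ⊆ (a^{[q]} : a) (b^{[q]} : b) + J^{[q]}` for `J = a + b`, stated for arbitrary
ideals in place of the Frobenius powers. -/
theorem colon_sumIdeal_le (V a : Ideal (MvPolynomial σ K)) (W b : Ideal (MvPolynomial τ K)) :
    (sumIdeal V W).colon (sumIdeal a b : Set (MvPolynomial (σ ⊕ τ) K)) ≤
      prodIdeal (V.colon (a : Set (MvPolynomial σ K))) (W.colon (b : Set (MvPolynomial τ K))) ⊔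
        sumIdeal V W := by
  intro h hh
  rw [Submodule.mem_colon] at hh
  obtain ⟨h, rfl⟩ := (tensorEquivSum K σ τ K).surjective h
  have key := mem_colon_mul_colon_sup (h := h) (V := V) (W := W) (a := a) (b := b)
    (fun x hx => ?_) fun y hy => ?_
  · have := Ideal.mem_map_of_mem (tensorToSum σ τ K) key
    rwa [Ideal.map_sup, Ideal.map_mul, map_tensorEquivSum_map_includeLeft,
      map_tensorEquivSum_map_includeRight, map_tensorSum] at this
  · rw [← apply_mem_sumIdeal_iff, map_mul]
    refine hh _ (Ideal.mem_sup_left ?_)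
    rw [tensorEquivSum_tmul_one]
    exact Ideal.mem_map_of_mem _ hx
  · rw [← apply_mem_sumIdeal_iff, map_mul]
    refine hh _ (Ideal.mem_sup_right ?_)
    rw [tensorEquivSum_one_tmul]
    exact Ideal.mem_map_of_mem _ hy

theorem prodIdeal_colon_le (V a : Ideal (MvPolynomial σ K)) (W b : Ideal (MvPolynomial τ K)) :
    prodIdeal (V.colon (a : Set (MvPolynomial σ K))) (W.colon (b : Set (MvPolynomial τ K))) ≤
      (sumIdeal V W).colon (sumIdeal a b : Set (MvPolynomial (σ ⊕ τ) K)) := by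
  have hl : (V.colon (a : Set (MvPolynomial σ K))).map
      (rename (R := K) (Sum.inl : σ → σ ⊕ τ)) * a.map (rename (R := K) Sum.inl) ≤
        sumIdeal V W := by
    rw [← Ideal.map_mul]
    refine le_sup_of_le_left (Ideal.map_mono (Ideal.mul_le.2 fun r hr s hs => ?_))
    exact Submodule.mem_colon.1 hr s hs
  have hr : (W.colon (b : Set (MvPolynomial τ K))).map
      (rename (R := K) (Sum.inr : τ → σ ⊕ τ)) * b.map (rename (R := K) Sum.inr) ≤
        sumIdeal V W := by
    rw [← Ideal.map_mul]
    refine le_sup_of_le_right (Ideal.map_mono (Ideal.mul_le.2 fun r hr s hs => ?_))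
    exact Submodule.mem_colon.1 hr s hs
  intro g hg
  rw [Submodule.mem_colon]
  intro x hx
  have h1 := Ideal.mul_mem_mul hg (SetLike.mem_coe.1 hx)
  rw [sumIdeal, Ideal.mul_sup, prodIdeal] at h1
  refine (sup_le ?_ ?_ : _ ≤ sumIdeal V W) h1
  · rw [mul_right_comm]
    exact Ideal.mul_le_left.trans hl
  · rw [mul_assoc]
    exact Ideal.mul_le_right.trans hr

/-- The `N`-th power of `a + b`, multiplied by `U V`, is not contained in `𝔫 + 𝔫'` if and only if
`N = r + s` where `a ^ r U` and `b ^ s V` are not contained in `𝔫` and `𝔫'`. -/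
theorem not_sumIdeal_pow_mul_le_iff {a U 𝔫 : Ideal (MvPolynomial σ K)}
    {b V 𝔫' : Ideal (MvPolynomial τ K)} {L : Ideal (MvPolynomial (σ ⊕ τ) K)}
    (hL : L ≤ sumIdeal 𝔫 𝔫') (N : ℕ) :
    ¬ sumIdeal a b ^ N * (prodIdeal U V ⊔ L) ≤ sumIdeal 𝔫 𝔫' ↔
      ∃ r s, r + s = N ∧ ¬ a ^ r * U ≤ 𝔫 ∧ ¬ b ^ s * V ≤ 𝔫' := by
  constructor
  · intro h
    by_contra! hcon
    apply h
    rw [Ideal.mul_sup]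
    refine sup_le ?_ (Ideal.mul_le_right.trans hL)
    rw [sumIdeal, ← Submodule.add_eq_sup, add_pow, Finset.sum_mul]
    refine (Finset.sum_induction _ (· ≤ sumIdeal 𝔫 𝔫') (fun _ _ => sup_le) bot_le ?_)
    intro r hr
    rw [Finset.mem_range, Nat.lt_succ_iff] at hr
    rw [mul_right_comm]
    refine Ideal.mul_le_left.trans ?_
    rw [prodIdeal, mul_mul_mul_comm, ← Ideal.map_pow, ← Ideal.map_pow, ← Ideal.map_mul,
      ← Ideal.map_mul]
    -- in each term `a ^ r b ^ s U V` one of the two factors lies in `𝔫` or `𝔫'`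
    by_cases hr' : a ^ r * U ≤ 𝔫
    · exact Ideal.mul_le_left.trans (le_sup_of_le_left (Ideal.map_mono hr'))
    · exact Ideal.mul_le_right.trans (le_sup_of_le_right (Ideal.map_mono
        (hcon r (N - r) (Nat.add_sub_cancel' hr) hr')))
  · rintro ⟨r, s, rfl, hr, hs⟩ h
    obtain ⟨f, hf, hf'⟩ := SetLike.not_le_iff_exists.1 hr
    obtain ⟨g, hg, hg'⟩ := SetLike.not_le_iff_exists.1 hs
    refine rename_mul_rename_notMem hf' hg' (h ?_)
    have h1 := Ideal.mul_mem_mul (Ideal.mem_map_of_mem (rename (R := K) (Sum.inl : σ → σ ⊕ τ)) hf)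
      (Ideal.mem_map_of_mem (rename (R := K) (Sum.inr : τ → σ ⊕ τ)) hg)
    rw [Ideal.map_mul, Ideal.map_mul, mul_mul_mul_comm, Ideal.map_pow, Ideal.map_pow] at h1
    refine Ideal.mul_mono ?_ le_sup_left h1
    rw [pow_add]
    exact Ideal.mul_mono (Ideal.pow_right_mono le_sup_left _)
      (Ideal.pow_right_mono le_sup_right _)

end SumIdeal

/-! ### Frobenius powers of the ideal of variables -/

section Vars

open MvPolynomial

variable {σ : Type} {K : Type u} [Field K] {p e : ℕ} [Fact p.Prime] [Algebra (ZMod p) K]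

theorem monomial_mem_frobPower_idealOfVars {β : σ →₀ ℕ} {i : σ} (h : p ^ e ≤ β i) (c : K) :
    monomial β c ∈ frobPower p e (idealOfVars σ K) := by
  classical
  have h1 : Finsupp.single i (p ^ e) ≤ β := Finsupp.single_le_iff.2 h
  rw [← tsub_add_cancel_of_le h1, ← mul_one c, ← monomial_mul, ← X_pow_eq_monomial]
  exact Ideal.mul_mem_left _ _ (pow_mem_frobPower (Ideal.subset_span ⟨i, rfl⟩))

/-- Polynomials outside `𝔪^{[q]}` have a monomial with all exponents less than `q`. -/
theorem exists_coeff_ne_zero_of_notMem_frobPower {f : MvPolynomial σ K}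
    (hf : f ∉ frobPower p e (idealOfVars σ K)) :
    ∃ β, coeff β f ≠ 0 ∧ ∀ i, β i < p ^ e := by
  by_contra! h
  refine hf ?_
  rw [f.as_sum]
  refine sum_mem fun β hβ => ?_
  obtain ⟨i, hi⟩ := h β (mem_support_iff.1 hβ)
  exact monomial_mem_frobPower_idealOfVars hi _

/-- By the pigeonhole principle, monomials of degree greater than `|σ| q` lie in `𝔪^{[q]}`. -/
theorem idealOfVars_pow_le_frobPower [Fintype σ] {N : ℕ} (hN : Fintype.card σ * p ^ e < N) :
    idealOfVars σ K ^ N ≤ frobPower p e (idealOfVars σ K) := by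
  rw [pow_idealOfVars_eq_span, Ideal.span_le]
  rintro _ ⟨β, hβ, rfl⟩
  by_contra hcon
  have h1 : ∀ i, β i ≤ p ^ e := fun i => by
    by_contra! h
    exact hcon (monomial_mem_frobPower_idealOfVars h.le 1)
  have h2 : β.degree = N := hβ
  rw [Finsupp.degree_eq_sum] at h2
  have h3 := Finset.sum_le_card_nsmul Finset.univ β _ fun i _ => h1 i
  rw [Finset.card_univ, smul_eq_mul] at h3
  exact absurd (h2 ▸ h3) (not_le.2 hN)

theorem one_notMem_idealOfVars : (1 : MvPolynomial σ K) ∉ idealOfVars σ K := by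
  intro h
  have := (C_mem_pow_idealOfVars_iff (σ := σ) 1 (1 : K)).1 (by simpa using h)
  simp at this

theorem one_notMem_frobPower_idealOfVars :
    (1 : MvPolynomial σ K) ∉ frobPower p e (idealOfVars σ K) := fun h =>
  one_notMem_idealOfVars (frobPower_le (fun _ hx => Ideal.pow_mem_of_mem _ hx _
    (pow_pos (Fact.out : p.Prime).pos e)) h)

end Vars

/-! ### The numbers `b_J(p^e)` -/

section BNum

variable {p e : ℕ} [Fact p.Prime] {R : Type u} [CommRing R] [Algebra (ZMod p) R]

/-- A nonempty, bounded, downward closed set of natural numbers is an initial segment. -/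
theorem exists_forall_iff_le {P : ℕ → Prop} (h0 : P 0) (hP : ∀ r s, r ≤ s → P s → P r)
    {N : ℕ} (hN : ¬ P (N + 1)) : ∃ n ≤ N, ∀ r, P r ↔ r ≤ n := by
  classical
  refine ⟨Nat.findGreatest P N, Nat.findGreatest_le _, fun r => ⟨fun h => ?_, fun h => ?_⟩⟩
  · refine Nat.le_findGreatest ?_ h
    by_contra! hr
    exact hN (hP _ _ hr h)
  · exact hP _ _ h (Nat.findGreatest_spec (Nat.zero_le _) h0)

theorem bNum_eq {𝔪 J : Ideal R} {n : ℕ}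
    (h : ∀ r, ¬ J ^ r ≤ splittingIdeal p e 𝔪 ↔ r ≤ n) : bNum p e 𝔪 J = n := by
  rw [bNum]
  refine le_antisymm (iSup₂_le fun r hr => by exact_mod_cast (h r).1 hr) ?_
  exact le_iSup₂_of_le n ((h n).2 le_rfl) le_rfl

end BNum

/-! ### Purity and splitting -/

section Purity

open TensorProduct

/-- If `1 ↦ m` is a pure map `R → M` into a finitely generated module over a Noetherian ring, then
it splits. A splitting amounts to a solution in `R` of a finite linear system that has a solution in
`M`; purity is tested on the cokernel of the matrix of that system. -/
theorem exists_apply_eq_one_of_pure {R M : Type u} [CommRing R] [IsNoetherianRing R]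
    [AddCommGroup M] [Module R M] [Module.Finite R M] (m : M)
    (h : ∀ (N : Type u) [AddCommGroup N] [Module R N],
      Function.Injective (LinearMap.rTensor N (LinearMap.toSpanSingleton R M m))) :
    ∃ φ : M →ₗ[R] R, φ m = 1 := by
  classical
  obtain ⟨k, π, hπ⟩ := Module.Finite.exists_fin' R M
  obtain ⟨l, κ, hκ⟩ := Submodule.fg_iff_exists_fin_generating_family.1
    (IsNoetherian.noetherian (LinearMap.ker π))
  obtain ⟨c, rfl⟩ := hπ m
  -- a splitting is a row vector `x` with `T x = (0, 1)`: it kills the relations of `M` and maps a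
  -- lift `c` of `m` to `1`
  let T : (Fin k → R) →ₗ[R] (Fin l → R) × R :=
    LinearMap.prod (LinearMap.pi fun i => Fintype.linearCombination R (κ i))
      (Fintype.linearCombination R c)
  let q := (LinearMap.range T).mkQ
  have hqT : ∀ x, q (T x) = 0 := fun x =>
    (Submodule.Quotient.mk_eq_zero _).2 (LinearMap.mem_range_self T x)
  have hπ' : ∀ v : Fin k → R, π v = ∑ j, v j • π (Pi.single j 1) := fun v => by
    conv_lhs => rw [pi_eq_sum_univ' v]
    simp [map_sum]
  have hT : ∀ j, T (Pi.single j 1) = ∑ i, κ i j • ((Pi.single i 1 : Fin l → R), (0 : R)) +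
      c j • ((0 : Fin l → R), (1 : R)) := by
    intro j
    ext i
    · simp [T, Prod.fst_sum, Finset.sum_apply, Pi.single_apply, Fintype.linearCombination_apply]
    · simp [T, Prod.snd_sum, Fintype.linearCombination_apply, Pi.single_apply]
  have hz : π c ⊗ₜ[R] q (0, 1) = 0 := by
    have h1 : ∑ j, π (Pi.single j 1) ⊗ₜ[R] q (T (Pi.single j 1)) = 0 :=
      Finset.sum_eq_zero fun j _ => by rw [hqT, tmul_zero]
    simp_rw [hT, map_add, map_sum, map_smul, tmul_add, tmul_sum, tmul_smul] at h1
    rw [Finset.sum_add_distrib, Finset.sum_comm] at h1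
    simp_rw [smul_tmul', ← sum_tmul, ← hπ'] at h1
    rwa [Finset.sum_eq_zero, zero_add] at h1
    intro i _
    have : κ i ∈ LinearMap.ker π := hκ ▸ Submodule.subset_span ⟨i, rfl⟩
    rw [LinearMap.mem_ker.1 this, zero_tmul]
  have hq : q (0, 1) = 0 := by
    have h2 : (1 : R) ⊗ₜ[R] q (0, 1) = 0 := by
      apply h
      rw [LinearMap.rTensor_tmul, map_zero]
      simpa using hz
    simpa using congrArg (TensorProduct.lid R _) h2
  obtain ⟨x, hx⟩ := LinearMap.mem_range.1 ((Submodule.Quotient.mk_eq_zero _).1 hq)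
  have hx1 : ∀ i, ∑ j, x j * κ i j = 0 := fun i => by
    simpa [T, Fintype.linearCombination_apply] using congrFun (congrArg Prod.fst hx) i
  have hx2 : ∑ j, x j * c j = 1 := by
    simpa [T, Fintype.linearCombination_apply] using congrArg Prod.snd hx
  have hker : LinearMap.ker π ≤ LinearMap.ker (Fintype.linearCombination R x) := by
    rw [← hκ, Submodule.span_le]
    rintro _ ⟨i, rfl⟩
    simpa [Fintype.linearCombination_apply, mul_comm] using hx1 i
  refine ⟨(LinearMap.ker π).liftQ _ hker ∘ₗ
    (π.quotKerEquivOfSurjective hπ).symm.toLinearMap, ?_⟩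
  have h3 : (π.quotKerEquivOfSurjective hπ).symm (π c) = Submodule.Quotient.mk c := by
    rw [LinearEquiv.symm_apply_eq]
    rfl
  rw [LinearMap.comp_apply, LinearEquiv.coe_coe, h3, Submodule.liftQ_apply]
  simpa [Fintype.linearCombination_apply, mul_comm] using hx2

variable {p : ℕ} [Fact p.Prime] {R : Type u} [CommRing R] [Algebra (ZMod p) R]

theorem IsFPure.exists_split [IsNoetherianRing R] [Module.Finite R (PRoot p 1 R)]
    (h : IsFPure p R) : ∃ ψ : PRoot p 1 R →ₗ[R] R, ψ (root p 1 1) = 1 :=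
  exists_apply_eq_one_of_pure _ h

theorem isFPure_of_split {ψ : PRoot p 1 R →ₗ[R] R} (h : ψ (root p 1 1) = 1) : IsFPure p R := by
  intro N _ _
  have h1 : ψ ∘ₗ LinearMap.toSpanSingleton R (PRoot p 1 R) (root p 1 1) = LinearMap.id := by
    ext
    simpa using h
  refine Function.LeftInverse.injective (g := LinearMap.rTensor N ψ) fun x => ?_
  rw [← LinearMap.comp_apply, ← LinearMap.rTensor_comp, h1, LinearMap.rTensor_id,
    LinearMap.id_apply]

/-- A splitting of `1 ↦ f^{1/p}`, precomposed with multiplication by `f^{1/p}`, splits Frobenius. -/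
theorem RootSplits.isFPure {f : R} (h : RootSplits p 1 f) : IsFPure p R := by
  obtain ⟨φ, hφ⟩ := rootSplits_iff.1 h
  let ψ : PRoot p 1 R →ₗ[R] R := linOfAdd
    (((φ : PRoot p 1 R →+ R).comp (root p 1).toAddMonoidHom).comp (AddMonoidHom.mulLeft f))
    fun a x => by
      change φ (root p 1 (f * (_ * x))) = a • φ (root p 1 (f * x))
      rw [mul_left_comm, map_root_pow_mul]
  refine isFPure_of_split (ψ := ψ) ?_
  change φ (root p 1 (f * 1)) = 1
  rw [mul_one, hφ]

/-- If Frobenius splits, then `f ^ p ∉ I_{e+1}` whenever `f ∉ I_e`: a splitting of Frobenius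
composed with `φ : R^{1/p^e} → R` maps `f ^ p` to `φ f`. -/
theorem pow_notMem_splittingIdeal {ψ : PRoot p 1 R →ₗ[R] R} (hψ : ψ (root p 1 1) = 1) {e : ℕ}
    {𝔪 : Ideal R} {f : R} (hf : f ∉ splittingIdeal p e 𝔪) :
    f ^ p ∉ splittingIdeal p (e + 1) 𝔪 := by
  rw [mem_splittingIdeal] at hf
  push Not at hf
  obtain ⟨φ, hφ⟩ := hf
  intro h
  have hψ' : ∀ a x, ψ (root p 1 (a ^ p * x)) = a * ψ (root p 1 x) := fun a x => by
    have := map_root_pow_mul ψ a x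
    rwa [pow_one] at this
  let χ : PRoot p (e + 1) R →ₗ[R] R := linOfAdd
    (((φ : PRoot p e R →+ R).comp (root p e).toAddMonoidHom).comp
      ((ψ : PRoot p 1 R →+ R).comp (root p 1).toAddMonoidHom))
    fun a x => by
      change φ (root p e (ψ (root p 1 _))) = a • φ (root p e (ψ (root p 1 x)))
      rw [pow_succ, pow_mul, hψ', map_root_pow_mul]
  have h1 : χ (root p (e + 1) (f ^ p)) ∈ 𝔪 := h χ
  have h2 : χ (root p (e + 1) (f ^ p)) = φ (root p e f) := by
    change φ (root p e (ψ (root p 1 (f ^ p)))) = _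
    rw [← mul_one (f ^ p), hψ', hψ, mul_one]
  exact hφ (h2 ▸ h1)

/-- `1 ∉ I_e(R)` for split Frobenius, starting from `I_0(R) = 𝔪`. -/
theorem one_notMem_splittingIdeal {ψ : PRoot p 1 R →ₗ[R] R} (hψ : ψ (root p 1 1) = 1)
    {𝔪 : Ideal R} (h𝔪 : (1 : R) ∉ 𝔪) (e : ℕ) : (1 : R) ∉ splittingIdeal p e 𝔪 := by
  induction e with
  | zero =>
    intro h
    exact h𝔪 (h (linOfAdd (AddMonoidHom.id R) fun a x => by simp))
  | succ e ih =>
    have := pow_notMem_splittingIdeal hψ ih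
    rwa [one_pow] at this

end Purity

/-! ### The `F`-pure threshold as a supremum -/

section Threshold

open Filter

variable {p : ℕ} [Fact p.Prime] {R : Type u} [CommRing R] [Algebra (ZMod p) R]

/-- If the pairs `(r, e)` for which some `f ∈ I ^ r` splits are those with `r ≤ b e`, and
`p b(e) ≤ b(e + 1)`, then the `F`-pure threshold of `I` is the supremum of the nondecreasing
sequence `b(e) / p^e`. -/
theorem fpt_eq_iSup {I : Ideal R} {b : ℕ → ℕ}
    (h : ∀ e r, (∃ f ∈ I ^ r, RootSplits p e f) ↔ r ≤ b e) (hb : ∀ e, p * b e ≤ b (e + 1)) :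
    fpt p I = ⨆ e, (b e : ℝ≥0∞) / (p : ℝ≥0∞) ^ e := by
  have hp0 : 0 < p := (Fact.out : p.Prime).pos
  have hp1 : 1 < p := (Fact.out : p.Prime).one_lt
  have hpe : ∀ e, (p : ℝ≥0∞) ^ e ≠ 0 := fun e => pow_ne_zero _ (by exact_mod_cast hp0.ne')
  have hpt : ∀ e, (p : ℝ≥0∞) ^ e ≠ ⊤ := fun e => ENNReal.pow_ne_top (ENNReal.natCast_ne_top p)
  have hpair : ∀ t, IsFPurePair p I t ↔ ∀ᶠ e in atTop, ⌊((p : ℝ) ^ e - 1) * (t : ℝ)⌋₊ ≤ b e :=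
    fun t => by simp_rw [IsFPurePair, h]
  refine le_antisymm (iSup₂_le fun t ht => ?_) (iSup_le fun e₀ => ?_)
  · -- `t p^e ≤ b(e) + 1 + t` for large `e`; divide by `p^e` and let `e` go to infinity
    have hlim : Tendsto (fun e : ℕ => (⨆ e, (b e : ℝ≥0∞) / (p : ℝ≥0∞) ^ e) +
        (1 + t) * ((p : ℝ≥0∞)⁻¹) ^ e) atTop
        (nhds ((⨆ e, (b e : ℝ≥0∞) / (p : ℝ≥0∞) ^ e) + (1 + t) * 0)) := by
      refine tendsto_const_nhds.add (ENNReal.Tendsto.const_mul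
        (ENNReal.tendsto_pow_atTop_nhds_zero_of_lt_one ?_) (Or.inr (by finiteness)))
      rw [ENNReal.inv_lt_one]
      exact_mod_cast hp1
    rw [mul_zero, add_zero] at hlim
    refine ge_of_tendsto hlim (((hpair t).1 ht).mono fun e he => ?_)
    have h1 : (t : ℝ) * (p : ℝ) ^ e ≤ b e + (1 + t) := by
      have h2 := (Nat.lt_floor_add_one (((p : ℝ) ^ e - 1) * (t : ℝ))).le
      have h3 : ((⌊((p : ℝ) ^ e - 1) * (t : ℝ)⌋₊ : ℕ) : ℝ) ≤ b e := by exact_mod_cast he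
      nlinarith
    have h4 : (t : ℝ≥0∞) * (p : ℝ≥0∞) ^ e ≤ b e + (1 + t) := by
      have : t * (p : ℝ≥0) ^ e ≤ b e + (1 + t) := by exact_mod_cast h1
      exact_mod_cast this
    calc (t : ℝ≥0∞) ≤ (b e + (1 + t)) / (p : ℝ≥0∞) ^ e :=
          (ENNReal.le_div_iff_mul_le (Or.inl (hpe e)) (Or.inl (hpt e))).2 h4
      _ = b e / (p : ℝ≥0∞) ^ e + (1 + t) * ((p : ℝ≥0∞)⁻¹) ^ e := by
          rw [ENNReal.add_div, ← ENNReal.inv_pow, ← div_eq_mul_inv]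
      _ ≤ _ := by gcongr; exact le_iSup (fun e => (b e : ℝ≥0∞) / (p : ℝ≥0∞) ^ e) e
  · -- `t = b(e₀) / p^{e₀}` satisfies `p^e t ≤ b(e)` for all `e ≥ e₀`
    have hmul : ∀ k, p ^ k * b e₀ ≤ b (e₀ + k) := by
      intro k
      induction k with
      | zero => simp
      | succ k ih =>
        rw [pow_succ', mul_assoc, ← add_assoc]
        exact (Nat.mul_le_mul_left p ih).trans (hb _)
    have hp : (p : ℝ) ≠ 0 := by exact_mod_cast hp0.ne'
    have ht : IsFPurePair p I ((b e₀ : ℝ≥0) / (p : ℝ≥0) ^ e₀) := by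
      rw [hpair]
      filter_upwards [eventually_ge_atTop e₀] with e he
      obtain ⟨k, rfl⟩ := Nat.exists_eq_add_of_le he
      refine Nat.floor_le_of_le (le_trans ?_ (Nat.cast_le.2 (hmul k)))
      push_cast
      rw [sub_mul, one_mul, pow_add]
      have h1 : (p : ℝ) ^ e₀ * (p : ℝ) ^ k * ((b e₀ : ℝ) / (p : ℝ) ^ e₀) =
          (p : ℝ) ^ k * b e₀ := by
        field_simp
      have h2 : 0 ≤ (b e₀ : ℝ) / (p : ℝ) ^ e₀ := by positivity
      linarith
    refine le_trans (le_of_eq ?_) (le_iSup₂_of_le _ ht le_rfl)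
    rw [ENNReal.coe_div (pow_ne_zero _ (by exact_mod_cast hp0.ne'))]
    push_cast
    rfl

end Threshold

/-! ### Homogeneous ideals -/

section Homogeneous

open MvPolynomial

attribute [local instance] MvPolynomial.gradedAlgebra

variable {σ τ : Type} {K : Type u} [Field K]

theorem exists_span_of_isHomogeneousIdeal {a : Ideal (MvPolynomial σ K)}
    (ha : IsHomogeneousIdeal a) : ∃ s : Set (MvPolynomial σ K), a = Ideal.span s ∧
      ∀ f ∈ s, SetLike.IsHomogeneousElem (homogeneousSubmodule σ K) f := by
  obtain ⟨S, hS⟩ := (Ideal.IsHomogeneous.iff_exists (homogeneousSubmodule σ K) a).1 ha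
  refine ⟨_, hS, ?_⟩
  rintro _ ⟨f, _, rfl⟩
  exact f.2

theorem isHomogeneousIdeal_span {s : Set (MvPolynomial σ K)}
    (hs : ∀ f ∈ s, SetLike.IsHomogeneousElem (homogeneousSubmodule σ K) f) :
    IsHomogeneousIdeal (Ideal.span s) :=
  Ideal.homogeneous_span _ s hs

theorem IsHomogeneousIdeal.map_rename {a : Ideal (MvPolynomial σ K)} (ha : IsHomogeneousIdeal a)
    (f : σ → τ) : IsHomogeneousIdeal (a.map (rename (R := K) f)) := by
  obtain ⟨s, rfl, hs⟩ := exists_span_of_isHomogeneousIdeal ha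
  rw [Ideal.map_span]
  refine isHomogeneousIdeal_span ?_
  rintro _ ⟨g, hg, rfl⟩
  obtain ⟨d, hd⟩ := hs g hg
  exact ⟨d, ((mem_homogeneousSubmodule d g).1 hd).rename_isHomogeneous⟩

theorem IsHomogeneousIdeal.sumIdeal {a : Ideal (MvPolynomial σ K)}
    {b : Ideal (MvPolynomial τ K)} (ha : IsHomogeneousIdeal a) (hb : IsHomogeneousIdeal b) :
    IsHomogeneousIdeal (sumIdeal a b) :=
  Ideal.IsHomogeneous.sup (𝒜 := homogeneousSubmodule (σ ⊕ τ) K) (ha.map_rename Sum.inl)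
    (hb.map_rename Sum.inr)

theorem isHomogeneousIdeal_idealOfVars_pow (N : ℕ) :
    IsHomogeneousIdeal (idealOfVars σ K ^ N) := by
  rw [pow_idealOfVars_eq_span]
  refine isHomogeneousIdeal_span ?_
  rintro _ ⟨β, hβ, rfl⟩
  exact ⟨N, isHomogeneous_monomial 1 hβ⟩

theorem IsHomogeneousIdeal.frobPower {p e : ℕ} [Fact p.Prime] [Algebra (ZMod p) K]
    {a : Ideal (MvPolynomial σ K)} (ha : IsHomogeneousIdeal a) :
    IsHomogeneousIdeal (frobPower p e a) := by
  obtain ⟨s, rfl, hs⟩ := exists_span_of_isHomogeneousIdeal ha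
  rw [FThreshold.frobPower, Ideal.map_span]
  refine isHomogeneousIdeal_span ?_
  rintro _ ⟨g, hg, rfl⟩
  obtain ⟨d, hd⟩ := hs g hg
  exact ⟨d * p ^ e, ((mem_homogeneousSubmodule d g).1 hd).pow (p ^ e)⟩

theorem IsHomogeneousIdeal.colon {a V : Ideal (MvPolynomial σ K)} (ha : IsHomogeneousIdeal a)
    (hV : IsHomogeneousIdeal V) :
    IsHomogeneousIdeal (V.colon (a : Set (MvPolynomial σ K))) := by
  classical
  intro i g hg
  rw [Submodule.mem_colon] at hg ⊢
  intro x hx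
  rw [← DirectSum.sum_support_decompose (homogeneousSubmodule σ K) x, Finset.smul_sum]
  refine sum_mem fun j _ => ?_
  have hxj := (DirectSum.decompose (homogeneousSubmodule σ K) x j).2
  rw [smul_eq_mul, ← DirectSum.coe_decompose_mul_add_of_right_mem _ hxj]
  exact hV _ (hg _ (ha j hx))

/-- If a product of homogeneous ideals is not contained in an ideal, this is witnessed by
homogeneous elements. -/
theorem exists_homogeneous_mul_notMem {U V W : Ideal (MvPolynomial σ K)}
    (hU : IsHomogeneousIdeal U) (hV : IsHomogeneousIdeal V) (h : ¬ U * V ≤ W) :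
    ∃ u ∈ U, ∃ v ∈ V, ∃ d, (u * v).IsHomogeneous d ∧ u * v ∉ W := by
  classical
  by_contra! hcon
  refine h (Ideal.mul_le.2 fun u hu v hv => ?_)
  rw [← DirectSum.sum_support_decompose (homogeneousSubmodule σ K) u,
    ← DirectSum.sum_support_decompose (homogeneousSubmodule σ K) v, Finset.sum_mul_sum]
  refine sum_mem fun i _ => sum_mem fun j _ => hcon _ (hU i hu) _ (hV j hv) (i + j) ?_
  exact ((mem_homogeneousSubmodule i _).1 (DirectSum.decompose _ u i).2).mul
    ((mem_homogeneousSubmodule j _).1 (DirectSum.decompose _ v j).2)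

end Homogeneous

/-! ### Splittings over quotients of polynomial rings -/

section Quotient

open MvPolynomial FrobeniusDual

variable {σ : Type} {K : Type u} [Field K] {p e : ℕ} [Fact p.Prime] [Algebra (ZMod p) K]

/-- If `f` is homogeneous and not in `𝔪^{[q]}`, the trace of a suitable multiple of `f` is a
nonzero constant: the multiple is chosen homogeneous of degree `|σ| (q - 1)`. -/
theorem exists_tr_eq_C [Fintype σ] [DecidableEq σ] (D : FrobeniusDual (p ^ e) K)
    {f : MvPolynomial σ K} {d : ℕ} (hf : f.IsHomogeneous d)
    (hf' : f ∉ frobPower p e (idealOfVars σ K)) :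
    ∃ h k, k ≠ 0 ∧ (D.mvPolynomial (σ := σ)).tr (h * f) = C k := by
  have hq : p ^ e ≠ 0 := pow_ne_zero e (Fact.out : p.Prime).ne_zero
  obtain ⟨β, hβ, hβq⟩ := exists_coeff_ne_zero_of_notMem_frobPower hf'
  obtain ⟨c, hc⟩ := D.exists_tr_ne_zero hq hβ
  have hle : β ≤ constExp σ (p ^ e - 1) := fun i => Nat.le_sub_one_of_lt (hβq i)
  refine ⟨monomial (constExp σ (p ^ e - 1) - β) c, D.tr (c * coeff β f), hc, ?_⟩
  ext γ
  rw [FrobeniusDual.mvPolynomial_tr, coeff_C]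
  split_ifs with hγ
  · subst hγ
    rw [smul_zero, zero_add, coeff_monomial_mul', if_pos tsub_le_self, tsub_tsub_cancel_of_le hle]
  · have hdeg : β.degree = d := by
      rw [Finsupp.degree_eq_weight_one]
      exact hf hβ
    have hhom := (isHomogeneous_monomial (R := K) c
      (rfl : (constExp σ (p ^ e - 1) - β).degree = _)).mul hf
    rw [hhom.coeff_eq_zero, map_zero]
    rw [map_add, map_nsmul, ← hdeg, ← map_add, tsub_add_cancel_of_le hle]
    intro h
    have h1 : p ^ e • γ.degree = 0 := by omega
    rw [smul_eq_mul, mul_eq_zero] at h1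
    exact hγ (((Finsupp.degree_eq_zero_iff γ).1 (h1.resolve_left hq)).symm)

/-- The colon ideal `J^{[p^e]} : J`. -/
def fedderColon (p e : ℕ) [Fact p.Prime] {R : Type u} [CommRing R] [Algebra (ZMod p) R]
    (J : Ideal R) : Ideal R :=
  (frobPower p e J).colon (J : Set R)

/-- Fedder's criterion for powers of the maximal homogeneous ideal of `S ⧸ J`. -/
theorem irrelevantQuot_pow_le_iff [Fintype σ] [DecidableEq σ] (D : FrobeniusDual (p ^ e) K)
    {J : Ideal (MvPolynomial σ K)} (hJ : J ≤ idealOfVars σ K) (N : ℕ) :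
    irrelevantQuot J ^ N ≤ splittingIdeal p e (irrelevantQuot J) ↔
      idealOfVars σ K ^ N * fedderColon p e J ≤ frobPower p e (idealOfVars σ K) := by
  rw [irrelevantQuot, ← Ideal.map_pow, Ideal.map_le_iff_le_comap, Ideal.mul_le]
  refine forall₂_congr fun x _ => ?_
  rw [Ideal.mem_comap, D.mvPolynomial.mk_mem_splittingIdeal_iff hJ]
  refine forall_congr' fun g => ?_
  rw [fedderColon, Submodule.mem_colon, mul_comm]
  rfl

/-- For homogeneous `J`, a power of `𝔪_R` not contained in `I_e(R)`, `R = S ⧸ J`, contains an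
element `f` such that `1 ↦ f^{1/p^e}` splits. -/
theorem exists_rootSplits [Fintype σ] [DecidableEq σ] (D : FrobeniusDual (p ^ e) K)
    {J : Ideal (MvPolynomial σ K)} (hJ : J ≤ idealOfVars σ K) (hJ' : IsHomogeneousIdeal J) {N : ℕ}
    (h : ¬ irrelevantQuot J ^ N ≤ splittingIdeal p e (irrelevantQuot J)) :
    ∃ f ∈ irrelevantQuot J ^ N, RootSplits p e f := by
  rw [irrelevantQuot_pow_le_iff D hJ] at h
  obtain ⟨f, hf, g, hg, d, hd, hfg⟩ := exists_homogeneous_mul_notMem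
    (isHomogeneousIdeal_idealOfVars_pow N) (hJ'.colon hJ'.frobPower) h
  obtain ⟨h, k, hk, hh⟩ := exists_tr_eq_C D hd hfg
  obtain ⟨φ, hφ⟩ := D.mvPolynomial.exists_descend (J := J) (g := h * g) fun x hx => by
    rw [mul_assoc]
    exact Ideal.mul_mem_left _ _ (Submodule.mem_colon.1 hg x hx)
  refine ⟨Ideal.Quotient.mk J f, ?_, rootSplits_iff.2
    ⟨Ideal.Quotient.mk J (C k⁻¹) • φ, ?_⟩⟩
  · rw [irrelevantQuot, ← Ideal.map_pow]
    exact Ideal.mem_map_of_mem _ hf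
  · rw [LinearMap.smul_apply, hφ, mul_assoc, mul_comm g f, hh, smul_eq_mul, ← map_mul, ← map_mul,
      inv_mul_cancel₀ hk, map_one, map_one]

theorem one_notMem_irrelevantQuot {J : Ideal (MvPolynomial σ K)} (hJ : J ≤ idealOfVars σ K) :
    (1 : MvPolynomial σ K ⧸ J) ∉ irrelevantQuot J := by
  rw [irrelevantQuot, ← map_one (Ideal.Quotient.mk J), Ideal.mem_quotient_iff_mem hJ]
  exact one_notMem_idealOfVars

theorem not_le_of_rootSplits {R : Type u} [CommRing R] [Algebra (ZMod p) R] {𝔪 I : Ideal R}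
    (h𝔪 : (1 : R) ∉ 𝔪) {f : R} (hf : f ∈ I) (h : RootSplits p e f) :
    ¬ I ≤ splittingIdeal p e 𝔪 := by
  intro hle
  obtain ⟨φ, hφ⟩ := rootSplits_iff.1 h
  exact h𝔪 (hφ ▸ hle hf φ)

theorem exists_rootSplits_iff [Fintype σ] [DecidableEq σ] (D : FrobeniusDual (p ^ e) K)
    {J : Ideal (MvPolynomial σ K)} (hJ : J ≤ idealOfVars σ K) (hJ' : IsHomogeneousIdeal J)
    (N : ℕ) : (∃ f ∈ irrelevantQuot J ^ N, RootSplits p e f) ↔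
      ¬ irrelevantQuot J ^ N ≤ splittingIdeal p e (irrelevantQuot J) :=
  ⟨fun ⟨_, hf, h⟩ => not_le_of_rootSplits (one_notMem_irrelevantQuot hJ) hf h,
    exists_rootSplits D hJ hJ'⟩

/-- For `F`-pure `S ⧸ J`, the powers of `𝔪_R` not contained in `I_e(R)` are those with exponent at
most `b e`, where `p b(e) ≤ b(e + 1)` and `b(e) ≤ |σ| p^e`. -/
theorem exists_bound_of_isFPure [Fintype σ] [DecidableEq σ]
    (D : ∀ e, FrobeniusDual (p ^ e) K) {J : Ideal (MvPolynomial σ K)}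
    (hJ : J ≤ idealOfVars σ K) (hpure : IsFPure p (MvPolynomial σ K ⧸ J)) :
    ∃ b : ℕ → ℕ, (∀ e r, ¬ irrelevantQuot J ^ r ≤ splittingIdeal p e (irrelevantQuot J) ↔
      r ≤ b e) ∧ (∀ e, p * b e ≤ b (e + 1)) ∧ ∀ e, b e ≤ Fintype.card σ * p ^ e := by
  have hfin : Module.Finite (MvPolynomial σ K ⧸ J) (PRoot p 1 (MvPolynomial σ K ⧸ J)) :=
    (D 1).mvPolynomial.finite_quotient J
  obtain ⟨ψ, hψ⟩ := hpure.exists_split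
  have key : ∀ e, ∃ n ≤ Fintype.card σ * p ^ e, ∀ r,
      ¬ irrelevantQuot J ^ r ≤ splittingIdeal p e (irrelevantQuot J) ↔ r ≤ n := by
    intro e
    refine exists_forall_iff_le (fun h => ?_)
      (fun r s hrs hs hr => hs ((Ideal.pow_le_pow_right hrs).trans hr)) ?_
    · exact one_notMem_splittingIdeal hψ (one_notMem_irrelevantQuot hJ) e (h (by simp))
    · rw [not_not, irrelevantQuot_pow_le_iff (D e) hJ]
      exact Ideal.mul_le_left.trans (idealOfVars_pow_le_frobPower (Nat.lt_succ_self _))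
  choose b hb hb' using key
  refine ⟨b, hb', fun e => ?_, hb⟩
  obtain ⟨f, hf, hf'⟩ := SetLike.not_le_iff_exists.1 ((hb' e _).2 le_rfl)
  rw [← hb']
  intro h
  have hfp := Ideal.pow_mem_pow hf p
  rw [← pow_mul, mul_comm] at hfp
  exact pow_notMem_splittingIdeal hψ hf' (h hfp)

end Quotient

/-! ### Additivity -/

section Additivity

open MvPolynomial FrobeniusDual

variable {σ τ : Type} {K : Type u} [Field K] {p e : ℕ} [Fact p.Prime] [Algebra (ZMod p) K]

theorem not_sumIdeal_pow_mul_le_iff_le {a U 𝔫 : Ideal (MvPolynomial σ K)}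
    {b V 𝔫' : Ideal (MvPolynomial τ K)} {L : Ideal (MvPolynomial (σ ⊕ τ) K)}
    (hL : L ≤ sumIdeal 𝔫 𝔫') {k l : ℕ} (ha : ∀ r, ¬ a ^ r * U ≤ 𝔫 ↔ r ≤ k)
    (hb : ∀ s, ¬ b ^ s * V ≤ 𝔫' ↔ s ≤ l) (N : ℕ) :
    ¬ sumIdeal a b ^ N * (prodIdeal U V ⊔ L) ≤ sumIdeal 𝔫 𝔫' ↔ N ≤ k + l := by
  rw [not_sumIdeal_pow_mul_le_iff hL]
  simp_rw [ha, hb]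
  constructor
  · rintro ⟨r, s, rfl, hr, hs⟩
    exact add_le_add hr hs
  · intro h
    exact ⟨min N k, N - min N k, by omega, by omega, by omega⟩

/-- The powers of `a` not contained in `I_e(S)` are those with exponent at most some `n`. -/
theorem exists_bound [Fintype σ] [DecidableEq σ] (D : FrobeniusDual (p ^ e) K)
    {a : Ideal (MvPolynomial σ K)} (ha : a ≤ idealOfVars σ K) :
    ∃ n : ℕ, ∀ r, ¬ a ^ r ≤ splittingIdeal p e (idealOfVars σ K) ↔ r ≤ n := by
  rw [D.mvPolynomial.splittingIdeal_eq]
  obtain ⟨n, -, hn⟩ := exists_forall_iff_le (P := fun r =>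
      ¬ a ^ r ≤ frobPower p e (idealOfVars σ K)) (N := Fintype.card σ * p ^ e)
    (fun h => one_notMem_frobPower_idealOfVars (h (by simp)))
    (fun r s hrs hs hr => hs ((Ideal.pow_le_pow_right hrs).trans hr))
    (not_not.2 ((Ideal.pow_right_mono ha _).trans
      (idealOfVars_pow_le_frobPower (Nat.lt_succ_self _))))
  exact ⟨n, hn⟩

/-- Additivity of `b_a(p^e)` and `b_b(p^e)` computed in the polynomial rings. -/
theorem not_sumIdeal_pow_le_splittingIdeal_iff [Fintype σ] [DecidableEq σ] [Fintype τ]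
    [DecidableEq τ] (D : FrobeniusDual (p ^ e) K) {a : Ideal (MvPolynomial σ K)}
    {b : Ideal (MvPolynomial τ K)} {k l : ℕ}
    (ha : ∀ r, ¬ a ^ r ≤ splittingIdeal p e (idealOfVars σ K) ↔ r ≤ k)
    (hb : ∀ r, ¬ b ^ r ≤ splittingIdeal p e (idealOfVars τ K) ↔ r ≤ l) (N : ℕ) :
    ¬ sumIdeal a b ^ N ≤ splittingIdeal p e (idealOfVars (σ ⊕ τ) K) ↔ N ≤ k + l := by
  have htop : prodIdeal (⊤ : Ideal (MvPolynomial σ K)) (⊤ : Ideal (MvPolynomial τ K)) ⊔ ⊥ =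
      ⊤ := by
    rw [prodIdeal, Ideal.map_top, Ideal.map_top, Ideal.top_mul, sup_bot_eq]
  -- this is the case `U = V = ⊤`, `L = ⊥` of the general statement
  rw [D.mvPolynomial.splittingIdeal_eq] at ha hb ⊢
  rw [← sumIdeal_idealOfVars, frobPower_sumIdeal, ← not_sumIdeal_pow_mul_le_iff_le (L := ⊥)
    bot_le (fun r => (Ideal.mul_top (a ^ r)).symm ▸ ha r)
    (fun r => (Ideal.mul_top (b ^ r)).symm ▸ hb r), htop, Ideal.mul_top]

theorem sumIdeal_le_idealOfVars {a : Ideal (MvPolynomial σ K)} {b : Ideal (MvPolynomial τ K)}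
    (ha : a ≤ idealOfVars σ K) (hb : b ≤ idealOfVars τ K) :
    sumIdeal a b ≤ idealOfVars (σ ⊕ τ) K :=
  (sumIdeal_mono ha hb).trans_eq sumIdeal_idealOfVars

/-- Compatibility of Fedder's colon ideal with sums of ideals in disjoint variables. -/
theorem fedderColon_sumIdeal (a : Ideal (MvPolynomial σ K)) (b : Ideal (MvPolynomial τ K)) :
    fedderColon p e (sumIdeal a b) =
      prodIdeal (fedderColon p e a) (fedderColon p e b) ⊔ frobPower p e (sumIdeal a b) := by
  refine le_antisymm ?_ (sup_le ?_ Ideal.le_colon)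
  · rw [fedderColon, frobPower_sumIdeal]
    exact colon_sumIdeal_le _ _ _ _
  · rw [fedderColon.eq_1 p e (sumIdeal a b), frobPower_sumIdeal]
    exact prodIdeal_colon_le _ _ _ _

/-- Additivity of `b_𝔪(p^e)` for the quotients by `a`, `b` and `a + b`. -/
theorem not_irrelevantQuot_sumIdeal_pow_le_iff [Fintype σ] [DecidableEq σ] [Fintype τ]
    [DecidableEq τ] (D : FrobeniusDual (p ^ e) K) {a : Ideal (MvPolynomial σ K)}
    {b : Ideal (MvPolynomial τ K)} (ha : a ≤ idealOfVars σ K) (hb : b ≤ idealOfVars τ K) {k l : ℕ}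
    (hk : ∀ r, ¬ irrelevantQuot a ^ r ≤ splittingIdeal p e (irrelevantQuot a) ↔ r ≤ k)
    (hl : ∀ r, ¬ irrelevantQuot b ^ r ≤ splittingIdeal p e (irrelevantQuot b) ↔ r ≤ l) (N : ℕ) :
    ¬ irrelevantQuot (sumIdeal a b) ^ N ≤
      splittingIdeal p e (irrelevantQuot (sumIdeal a b)) ↔ N ≤ k + l := by
  simp_rw [irrelevantQuot_pow_le_iff D ha] at hk
  simp_rw [irrelevantQuot_pow_le_iff D hb] at hl
  rw [irrelevantQuot_pow_le_iff D (sumIdeal_le_idealOfVars ha hb), fedderColon_sumIdeal,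
    ← sumIdeal_idealOfVars, frobPower_sumIdeal (idealOfVars σ K)]
  refine not_sumIdeal_pow_mul_le_iff_le ?_ hk hl N
  rw [frobPower_sumIdeal]
  exact sumIdeal_mono (frobPower_mono ha) (frobPower_mono hb)

theorem monotone_div_pow {b : ℕ → ℕ} (hb : ∀ e, p * b e ≤ b (e + 1)) :
    Monotone fun e => (b e : ℝ≥0∞) / (p : ℝ≥0∞) ^ e := by
  have hp : (p : ℝ≥0∞) ≠ 0 := by exact_mod_cast (Fact.out : p.Prime).ne_zero
  refine monotone_nat_of_le_succ fun e => ?_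
  rw [← ENNReal.mul_div_mul_left (b e : ℝ≥0∞) _ hp (ENNReal.natCast_ne_top p), ← pow_succ']
  gcongr
  exact_mod_cast hb e

theorem iSup_div_pow_lt_top {q : ℕ} {b : ℕ → ℕ} {c : ℕ} (hb : ∀ e, b e ≤ c * q ^ e) :
    ⨆ e, (b e : ℝ≥0∞) / (q : ℝ≥0∞) ^ e < ⊤ := by
  refine lt_of_le_of_lt (iSup_le fun e => ENNReal.div_le_of_le_mul ?_)
    (ENNReal.natCast_lt_top c)
  exact_mod_cast hb e

end Additivity

end FThreshold

theorem mainTheorem9 (p : ℕ) [Fact p.Prime] (K : Type u) [Field K] [Algebra (ZMod p) K]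
    (hK : FThreshold.IsFFinite p K) (n m : ℕ)
    (a : Ideal (MvPolynomial (Fin n) K)) (b : Ideal (MvPolynomial (Fin m) K))
    (ha : a ≤ MvPolynomial.idealOfVars (Fin n) K) (hb : b ≤ MvPolynomial.idealOfVars (Fin m) K) :
    (∀ e : ℕ,
      FThreshold.bNum p e (MvPolynomial.idealOfVars (Fin n ⊕ Fin m) K) (FThreshold.sumIdeal a b)
          = FThreshold.bNum p e (MvPolynomial.idealOfVars (Fin n) K) a
            + FThreshold.bNum p e (MvPolynomial.idealOfVars (Fin m) K) b ∧
      FThreshold.bNum p e (MvPolynomial.idealOfVars (Fin n ⊕ Fin m) K)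
          (FThreshold.sumIdeal a b) < ⊤) ∧
    (FThreshold.IsHomogeneousIdeal a →
      FThreshold.IsHomogeneousIdeal b →
      FThreshold.IsFPure p (MvPolynomial (Fin n) K ⧸ a) →
      FThreshold.IsFPure p (MvPolynomial (Fin m) K ⧸ b) →
      FThreshold.IsFPure p (MvPolynomial (Fin n ⊕ Fin m) K ⧸ FThreshold.sumIdeal a b) ∧
      (∀ e : ℕ,
        FThreshold.bQuot p e (FThreshold.sumIdeal a b)
            = FThreshold.bQuot p e a + FThreshold.bQuot p e b ∧
        FThreshold.bQuot p e (FThreshold.sumIdeal a b) < ⊤) ∧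
      FThreshold.fptQuot p (FThreshold.sumIdeal a b)
          = FThreshold.fptQuot p a + FThreshold.fptQuot p b ∧
      FThreshold.fptQuot p (FThreshold.sumIdeal a b) < ⊤) := by
  have D : ∀ e, FThreshold.FrobeniusDual (p ^ e) K := fun e =>
    Classical.choice (FThreshold.FrobeniusDual.nonempty_of_isFFinite hK e)
  refine ⟨fun e => ?_, fun ha' hb' hpa hpb => ?_⟩
  · obtain ⟨k, hk⟩ := FThreshold.exists_bound (D e) ha
    obtain ⟨l, hl⟩ := FThreshold.exists_bound (D e) hb
    rw [FThreshold.bNum_eq (FThreshold.not_sumIdeal_pow_le_splittingIdeal_iff (D e) hk hl),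
      FThreshold.bNum_eq hk, FThreshold.bNum_eq hl]
    exact ⟨Nat.cast_add k l, ENat.natCast_lt_top _⟩
  · obtain ⟨k, hk, hk1, hk2⟩ := FThreshold.exists_bound_of_isFPure D ha hpa
    obtain ⟨l, hl, hl1, hl2⟩ := FThreshold.exists_bound_of_isFPure D hb hpb
    have hJ := FThreshold.sumIdeal_le_idealOfVars ha hb
    have hJ' := ha'.sumIdeal hb'
    have hkl := fun e =>
      FThreshold.not_irrelevantQuot_sumIdeal_pow_le_iff (D e) ha hb (hk e) (hl e)
    have hfa : FThreshold.fptQuot p a = _ := FThreshold.fpt_eq_iSup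
      (fun e r => (FThreshold.exists_rootSplits_iff (D e) ha ha' r).trans (hk e r)) hk1
    have hfb : FThreshold.fptQuot p b = _ := FThreshold.fpt_eq_iSup
      (fun e r => (FThreshold.exists_rootSplits_iff (D e) hb hb' r).trans (hl e r)) hl1
    have hfJ : FThreshold.fptQuot p (FThreshold.sumIdeal a b) = _ :=
      FThreshold.fpt_eq_iSup (b := fun e => k e + l e)
        (fun e r => (FThreshold.exists_rootSplits_iff (D e) hJ hJ' r).trans (hkl e r))
        fun e => by rw [mul_add]; exact add_le_add (hk1 e) (hl1 e)
    have hsum : FThreshold.fptQuot p (FThreshold.sumIdeal a b) =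
        FThreshold.fptQuot p a + FThreshold.fptQuot p b := by
      rw [hfJ, hfa, hfb, ENNReal.iSup_add_iSup_of_monotone (FThreshold.monotone_div_pow hk1)
        (FThreshold.monotone_div_pow hl1)]
      simp_rw [Nat.cast_add, ENNReal.add_div]
    refine ⟨?_, fun e => ?_, hsum, ?_⟩
    · -- `b(p) ≥ 0` already says that `1 ∉ I_1`, so some `1 ↦ f^{1/p}` splits
      obtain ⟨f, -, hf⟩ := (FThreshold.exists_rootSplits_iff (D 1) hJ hJ' 0).2
        ((hkl 1 0).2 (Nat.zero_le _))
      exact hf.isFPure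
    · rw [FThreshold.bQuot, FThreshold.bQuot, FThreshold.bQuot, FThreshold.bNum_eq (hkl e),
        FThreshold.bNum_eq (hk e), FThreshold.bNum_eq (hl e)]
      exact ⟨Nat.cast_add (k e) (l e), ENat.natCast_lt_top _⟩
    · rw [hsum, hfa, hfb]
      exact ENNReal.add_lt_top.2 ⟨FThreshold.iSup_div_pow_lt_top hk2,
        FThreshold.iSup_div_pow_lt_top hl2⟩
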